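/- Fix a nonstandard embedding $*$ satisfying the Transfer Principle (no particular construction and no saturation is required). Let $B$ be an internal Dedekind ring, i.e. an internal ring satisfying the transfer of the definition of a Dedekind domain (a member of ${}^*\mathcal D$ for some set $\mathcal D$ of Dedekind domains), and suppose that $B$ is not a field. Ideals of $B$ may be internal or external. For $x\in B$ and $n\in{}^*\mathbb N$ let $x^n$ be the extended power. An ideal $\mathfrak a$ of $B$ is called $*$-radical if it equals ${}^*\mathrm{Rad}(\mathfrak a)=\{x\in B : x^n\in\mathfrak a \text{ for some } n\in{}^*\mathbb N\}$. Let $\mathcal M$ be the set of internal maximal ideals of $B$, let $\mathcal L$ be the lattice of hyperfinite subsets of $\mathcal M$ ordered by inclusion, and let ${}^*\bigoplus_{\mathcal M}{}^*\mathbb N$ be the lattice of internal functions $\mathcal M\to{}^*\mathbb N$ with hyperfinite support, ordered pointwise. A nonzero internal ideal $\mathfrak b$ has a divisor $\mathrm{div}(\mathfrak b)\in{}^*\bigoplus_{\mathcal M}{}^*\mathbb N$, whose value at $\mathfrak p$ is the largest $n\in{}^*\mathbb N$ with $\mathfrak b\subseteq\mathfrak p^n$. A nonzero ideal $\mathfrak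 a$ of $B$ corresponds to the filter $$\Phi(\mathfrak a)=\{\mathrm{div}(\mathfrak b) : 0\ne\mathfrak b\subseteq\mathfrak a,\ \mathfrak b \text{ an internal ideal}\}$$ on ${}^*\bigoplus_{\mathcal M}{}^*\mathbb N$, and a filter $\mathcal F$ on ${}^*\bigoplus_{\mathcal M}{}^*\mathbb N$ corresponds to the ideal $\Psi(\mathcal F)=\bigcup\{\mathfrak b : \mathfrak b\ne0 \text{ an internal ideal},\ \mathrm{div}(\mathfrak b)\in\mathcal F\}$. For $f\in{}^*\bigoplus_{\mathcal M}{}^*\mathbb N$ let $\mathrm{supp}(f)=\{\mathfrak p\in\mathcal M : f(\mathfrak p)\ne0\}$, and for $S\in\mathcal L$ let $\mathrm{ch}(S)$ be its characteristic function. Put $Supp(\mathcal F)=\{\mathrm{supp}(f) : f\in\mathcal F\}$ for a filter $\mathcal F$ on ${}^*\bigoplus_{\mathcal M}{}^*\mathbb N$, and $Ch(\mathcal S)=\{f : \mathrm{ch}(S)\le f\text{ for some }S\in\mathcal S\}$ for a filter $\mathcal S$ on $\mathcal L$. Filters are non-empty; a filter is proper if it is not the whole lattice, an ultrafilter is a maximal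 proper filter, a filter is principal if it has a least element, and free otherwise. (a) The maps $\mathfrak a\mapsto Supp(\Phi(\mathfrak a))$ and $\mathcal S\mapsto\Psi(Ch(\mathcal S))$ are mutually inverse bijections between the proper nonzero $*$-radical ideals of $B$ and the proper filters on $\mathcal L$. Under this correspondence $\mathfrak a$ is internal if and only if the associated filter is principal. (b) The same maps are mutually inverse bijections between the maximal ideals of $B$ and the ultrafilters on $\mathcal L$. A maximal ideal is internal if and only if its ultrafilter is principal, and external if and only if its ultrafilter is free. -/

import Mathlib

universe u v

set_option linter.checkUnivs false in
/-- A nonstandard embedding `*`, in its functorial form. Every set `X` has an extension `*X`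
(`obj X`), every function `f : X → Y` has an extension `*f : *X → *Y` (`map f`) and every subset
`A ⊆ X` has an extension `*A ⊆ *X` (`ext A`). The laws are the Transfer Principle, one clause for
each way of building a formula: terms (`map_id`, `map_comp`, `ext_preimage`), equality (`ext_eq`),
negation (`ext_compl`), conjunction (`ext_inter`), existential quantifiers (`ext_image`), and
tuples of variables (`exists_pair`, `pair_unique`: `*(X × Y) = *X × *Y`). Quantifiers over sets and
functions are covered, because `X` may itself be a set of sets or of functions.
No particular construction of `*` and no degree of saturation is required. -/
structure NonstandardEmbedding where
  obj : Type u → Type v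
  map : ∀ {X Y : Type u}, (X → Y) → obj X → obj Y
  ext : ∀ {X : Type u}, Set X → Set (obj X)
  nonempty_point : Nonempty (obj PUnit)
  map_id : ∀ {X : Type u} (x : obj X), map (fun a : X => a) x = x
  map_comp : ∀ {X Y Z : Type u} (g : Y → Z) (f : X → Y) (x : obj X),
    map (fun a => g (f a)) x = map g (map f x)
  ext_compl : ∀ {X : Type u} (A : Set X), ext Aᶜ = (ext A)ᶜ
  ext_inter : ∀ {X : Type u} (A B : Set X), ext (A ∩ B) = ext A ∩ ext B
  ext_preimage : ∀ {X Y : Type u} (f : X → Y) (A : Set Y), ext (f ⁻¹' A) = map f ⁻¹' ext A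
  ext_image : ∀ {X Y : Type u} (f : X → Y) (A : Set X), ext (f '' A) = map f '' ext A
  ext_eq : ∀ {X Y : Type u} (f g : X → Y), ext {a | f a = g a} = {x | map f x = map g x}
  exists_pair : ∀ {X Y : Type u} (x : obj X) (y : obj Y),
    ∃ z : obj (X × Y), map Prod.fst z = x ∧ map Prod.snd z = y
  pair_unique : ∀ {X Y : Type u} (z w : obj (X × Y)),
    map Prod.fst z = map Prod.fst w → map Prod.snd z = map Prod.snd w → z = w

namespace NonstandardEmbedding

variable (N : NonstandardEmbedding.{u, v})

theorem ext_univ (X : Type u) : N.ext (Set.univ : Set X) = Set.univ := by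
  have h := N.ext_eq (fun a : X => a) (fun a : X => a)
  simpa using h

theorem ext_mono {X : Type u} {A B : Set X} (h : A ⊆ B) : N.ext A ⊆ N.ext B := by
  have h1 := N.ext_inter A B
  rw [Set.inter_eq_left.2 h] at h1
  rw [h1]
  exact Set.inter_subset_right

theorem map_injective {X Y : Type u} {f : X → Y} (hf : Function.Injective f) :
    Function.Injective (N.map f) := by
  intro z w h
  obtain ⟨p, hp1, hp2⟩ := N.exists_pair z w
  have h1 : p ∈ N.ext {q : X × X | f q.1 = f q.2} := by
    rw [N.ext_eq (fun q : X × X => f q.1) (fun q : X × X => f q.2)]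
    show N.map (fun q : X × X => f q.1) p = N.map (fun q : X × X => f q.2) p
    rw [N.map_comp f Prod.fst, N.map_comp f Prod.snd, hp1, hp2, h]
  have h2 : p ∈ N.ext {q : X × X | q.1 = q.2} := N.ext_mono (fun q hq => hf hq) h1
  rw [N.ext_eq (fun q : X × X => q.1) (fun q : X × X => q.2)] at h2
  exact hp1.symm.trans (Eq.trans h2 hp2)

/-- The point of `*(X × Y)` with given coordinates. -/
noncomputable def pair {X Y : Type u} (x : N.obj X) (y : N.obj Y) : N.obj (X × Y) :=
  (N.exists_pair x y).choose

theorem map_fst_pair {X Y : Type u} (x : N.obj X) (y : N.obj Y) :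
    N.map Prod.fst (N.pair x y) = x := (N.exists_pair x y).choose_spec.1

theorem map_snd_pair {X Y : Type u} (x : N.obj X) (y : N.obj Y) :
    N.map Prod.snd (N.pair x y) = y := (N.exists_pair x y).choose_spec.2

theorem pair_map {W X Y : Type u} (f : W → X) (g : W → Y) (w : N.obj W) :
    N.pair (N.map f w) (N.map g w) = N.map (fun a => (f a, g a)) w := by
  apply N.pair_unique
  · rw [N.map_fst_pair, ← N.map_comp]
  · rw [N.map_snd_pair, ← N.map_comp]

/-! ### The hypernatural numbers -/

/-- `*ℕ`. -/
def HyperNat : Type v := N.obj (ULift.{u} ℕ)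

/-- The standard hypernatural number `k`. -/
noncomputable def natCast (k : ℕ) : N.HyperNat :=
  N.map (fun _ : PUnit => ULift.up k) N.nonempty_point.some

/-- The order of `*ℕ` is the extension of the order of `ℕ`. -/
noncomputable instance : PartialOrder N.HyperNat where
  le a b := N.pair (X := ULift.{u} ℕ) (Y := ULift.{u} ℕ) a b ∈ N.ext {q | q.1.down ≤ q.2.down}
  le_refl a := by
    have h : N.pair (X := ULift.{u} ℕ) (Y := ULift.{u} ℕ) a a
        = N.map (fun k : ULift.{u} ℕ => (k, k)) a := by
      have h0 := N.pair_map (fun k : ULift.{u} ℕ => k) (fun k => k) a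
      have h1 := N.map_id (X := ULift.{u} ℕ) a
      rwa [h1] at h0
    show N.pair (X := ULift.{u} ℕ) (Y := ULift.{u} ℕ) a a ∈ _
    rw [h]
    show a ∈ N.map (fun k : ULift.{u} ℕ => (k, k)) ⁻¹' _
    rw [← N.ext_preimage]
    have : (fun k : ULift.{u} ℕ => (k, k)) ⁻¹' {q | q.1.down ≤ q.2.down} = Set.univ := by
      ext k; simp
    rw [this, N.ext_univ]
    trivial
  le_trans a b c hab hbc := by
    obtain ⟨p, hp1, hp2⟩ := N.exists_pair (X := ULift.{u} ℕ) (Y := ULift.{u} ℕ) a b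
    obtain ⟨w, hw1, hw2⟩ := N.exists_pair (Y := ULift.{u} ℕ) p c
    have ea : a = N.map (fun t : (ULift.{u} ℕ × ULift.{u} ℕ) × ULift.{u} ℕ => t.1.1) w := by
      rw [N.map_comp Prod.fst Prod.fst, hw1, hp1]
    have eb : b = N.map (fun t : (ULift.{u} ℕ × ULift.{u} ℕ) × ULift.{u} ℕ => t.1.2) w := by
      rw [N.map_comp Prod.snd Prod.fst, hw1, hp2]
    have ec : c = N.map (fun t : (ULift.{u} ℕ × ULift.{u} ℕ) × ULift.{u} ℕ => t.2) w := hw2.symm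
    change N.pair (X := ULift.{u} ℕ) (Y := ULift.{u} ℕ) a b ∈ _ at hab
    change N.pair (X := ULift.{u} ℕ) (Y := ULift.{u} ℕ) b c ∈ _ at hbc
    show N.pair (X := ULift.{u} ℕ) (Y := ULift.{u} ℕ) a c ∈ _
    rw [ea, eb, N.pair_map, ← Set.mem_preimage, ← N.ext_preimage] at hab
    rw [eb, ec, N.pair_map, ← Set.mem_preimage, ← N.ext_preimage] at hbc
    rw [ea, ec, N.pair_map, ← Set.mem_preimage, ← N.ext_preimage]
    have h := Set.mem_inter hab hbc
    rw [← N.ext_inter] at h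
    refine N.ext_mono (fun t ht => ?_) h
    exact le_trans (show t.1.1.down ≤ t.1.2.down from ht.1) (show t.1.2.down ≤ t.2.down from ht.2)
  le_antisymm a b hab hba := by
    obtain ⟨w, hw1, hw2⟩ := N.exists_pair (X := ULift.{u} ℕ) (Y := ULift.{u} ℕ) a b
    change N.pair (X := ULift.{u} ℕ) (Y := ULift.{u} ℕ) a b ∈ _ at hab
    change N.pair (X := ULift.{u} ℕ) (Y := ULift.{u} ℕ) b a ∈ _ at hba
    rw [← hw1, ← hw2, N.pair_map, ← Set.mem_preimage, ← N.ext_preimage] at hab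
    rw [← hw1, ← hw2, N.pair_map, ← Set.mem_preimage, ← N.ext_preimage] at hba
    have h := Set.mem_inter hab hba
    rw [← N.ext_inter] at h
    have h2 : w ∈ N.ext {q : ULift.{u} ℕ × ULift.{u} ℕ | q.1 = q.2} :=
      N.ext_mono (fun t ht => ULift.ext _ _ (le_antisymm ht.1 ht.2)) h
    rw [N.ext_eq (fun q : ULift.{u} ℕ × ULift.{u} ℕ => q.1) (fun q => q.2)] at h2
    exact hw1.symm.trans (Eq.trans h2 hw2)

/-! ### Members of extended families -/

variable {I : Type u}

/-- The internal set `*X_i` with index `i ∈ *I` in the extension of a family of sets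
`(X_i)_{i ∈ I}`: the fibre over `i` of `*(⨆ X_i) → *I`, where `⨆` is the disjoint union. If `*` is
given by ultrapowers, these are the ultraproducts of members of the family. -/
def Fiber (X : I → Type u) (i : N.obj I) : Type v :=
  {z : N.obj (Σ j, X j) // N.map Sigma.fst z = i}

variable {N} {A W X Y Z : I → Type u} {i : N.obj I}

namespace Fiber

theorem exists_pair (x : N.Fiber X i) (y : N.Fiber Y i) :
    ∃ z : N.Fiber (fun j => X j × Y j) i,
      N.map (fun t => (⟨t.1, t.2.1⟩ : Σ j, X j)) z.1 = x.1 ∧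
      N.map (fun t => (⟨t.1, t.2.2⟩ : Σ j, Y j)) z.1 = y.1 := by
  obtain ⟨w, hw1, hw2⟩ := N.exists_pair x.1 y.1
  let g : (Σ j, X j × Y j) → (Σ j, X j) × (Σ j, Y j) :=
    fun t => (⟨t.1, t.2.1⟩, ⟨t.1, t.2.2⟩)
  have h1 : w ∈ N.ext {q : (Σ j, X j) × (Σ j, Y j) | q.1.1 = q.2.1} := by
    rw [N.ext_eq (fun q : (Σ j, X j) × (Σ j, Y j) => q.1.1) (fun q => q.2.1)]
    show N.map (fun q : (Σ j, X j) × (Σ j, Y j) => q.1.1) w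
      = N.map (fun q : (Σ j, X j) × (Σ j, Y j) => q.2.1) w
    rw [N.map_comp Sigma.fst Prod.fst, N.map_comp Sigma.fst Prod.snd, hw1, hw2, x.2, y.2]
  have h2 : w ∈ N.ext (g '' Set.univ) := by
    refine N.ext_mono ?_ h1
    rintro ⟨⟨j, a⟩, ⟨k, b⟩⟩ h
    obtain rfl : j = k := h
    exact ⟨⟨j, a, b⟩, trivial, rfl⟩
  rw [N.ext_image] at h2
  obtain ⟨z, -, hz⟩ := h2
  have hx : N.map (fun t => (⟨t.1, t.2.1⟩ : Σ j, X j)) z = x.1 := by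
    rw [← hw1, ← hz, ← N.map_comp]
  have hy : N.map (fun t => (⟨t.1, t.2.2⟩ : Σ j, Y j)) z = y.1 := by
    rw [← hw2, ← hz, ← N.map_comp]
  refine ⟨⟨z, ?_⟩, hx, hy⟩
  rw [← x.2, ← hx, ← N.map_comp]

/-- Pairing of members of two internal sets with the same index. -/
noncomputable def pair (x : N.Fiber X i) (y : N.Fiber Y i) : N.Fiber (fun j => X j × Y j) i :=
  (exists_pair x y).choose

/-- The extension of a family of functions `X_j → Y_j`. -/
def map (f : ∀ j, X j → Y j) (x : N.Fiber X i) : N.Fiber Y i :=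
  ⟨N.map (fun t => ⟨t.1, f t.1 t.2⟩) x.1, by rw [← N.map_comp]; exact x.2⟩

theorem map_map (g : ∀ j, Y j → Z j) (f : ∀ j, X j → Y j) (x : N.Fiber X i) :
    map g (map f x) = map (fun j a => g j (f j a)) x :=
  Subtype.ext (N.map_comp _ _ _).symm

theorem map_id' (x : N.Fiber X i) : map (fun _ a => a) x = x := Subtype.ext (N.map_id x.1)

theorem map_fst_pair (x : N.Fiber X i) (y : N.Fiber Y i) :
    map (fun _ q => q.1) (pair x y) = x := Subtype.ext (exists_pair x y).choose_spec.1

theorem map_snd_pair (x : N.Fiber X i) (y : N.Fiber Y i) :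
    map (fun _ q => q.2) (pair x y) = y := Subtype.ext (exists_pair x y).choose_spec.2

theorem pair_unique (z w : N.Fiber (fun j => X j × Y j) i)
    (h1 : map (fun _ q => q.1) z = map (fun _ q => q.1) w)
    (h2 : map (fun _ q => q.2) z = map (fun _ q => q.2) w) : z = w := by
  let g : (Σ j, X j × Y j) → (Σ j, X j) × (Σ j, Y j) :=
    fun t => (⟨t.1, t.2.1⟩, ⟨t.1, t.2.2⟩)
  have hg : Function.Injective g := by
    rintro ⟨j, a, b⟩ ⟨k, c, d⟩ h
    simp only [g, Prod.mk.injEq, Sigma.mk.injEq] at h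
    obtain ⟨⟨rfl, h3⟩, -, h4⟩ := h
    simp_all
  apply Subtype.ext
  apply N.map_injective hg
  apply N.pair_unique
  · rw [← N.map_comp, ← N.map_comp]
    exact congrArg Subtype.val h1
  · rw [← N.map_comp, ← N.map_comp]
    exact congrArg Subtype.val h2

theorem pair_map (f : ∀ j, W j → X j) (g : ∀ j, W j → Y j) (w : N.Fiber W i) :
    pair (map f w) (map g w) = map (fun j a => (f j a, g j a)) w := by
  apply pair_unique
  · rw [map_fst_pair, map_map]
  · rw [map_snd_pair, map_map]

/-- The extension of a family of binary operations. -/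
noncomputable def op (f : ∀ j, X j → Y j → Z j) (x : N.Fiber X i) (y : N.Fiber Y i) :
    N.Fiber Z i := map (fun j q => f j q.1 q.2) (pair x y)

/-- The extension of a family of binary relations. -/
def Rel (R : ∀ j, X j → Y j → Prop) (x : N.Fiber X i) (y : N.Fiber Y i) : Prop :=
  (pair x y).1 ∈ N.ext {t | R t.1 t.2.1 t.2.2}

/-- The member of `*X_i` given by a standard family of members of the `X_j`. -/
def const (c : ∀ j, X j) : N.Fiber X i :=
  ⟨N.map (fun j => ⟨j, c j⟩) i, by rw [← N.map_comp]; exact N.map_id i⟩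

/-- A point of `*T`, seen as a member of the extension of the constant family `T`. -/
noncomputable def ofObj {T : Type u} (t : N.obj T) : N.Fiber (fun _ : I => T) i :=
  ⟨N.map (fun q => ⟨q.1, q.2⟩) (N.pair i t), by
    rw [← N.map_comp]; exact N.map_fst_pair i t⟩

/-- The inverse of `ofObj`. -/
def toObj {T : Type u} (x : N.Fiber (fun _ : I => T) i) : N.obj T := N.map (fun q => q.2) x.1

theorem op_map (f : ∀ j, X j → Y j → Z j) (g : ∀ j, W j → X j) (h : ∀ j, W j → Y j)
    (w : N.Fiber W i) : op f (map g w) (map h w) = map (fun j a => f j (g j a) (h j a)) w := by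
  rw [op, pair_map, map_map]

theorem const_eq_map (c : ∀ j, X j) (w : N.Fiber W i) : const c = map (fun j _ => c j) w := by
  apply Subtype.ext
  have h := N.map_comp (fun j => (⟨j, c j⟩ : Σ j, X j)) Sigma.fst w.1
  rw [w.2] at h
  exact h.symm

theorem exists_two (x : N.Fiber X i) (y : N.Fiber Y i) :
    ∃ w : N.Fiber (fun j => X j × Y j) i,
      x = map (fun _ q => q.1) w ∧ y = map (fun _ q => q.2) w :=
  ⟨pair x y, (map_fst_pair x y).symm, (map_snd_pair x y).symm⟩

theorem exists_three (x : N.Fiber X i) (y : N.Fiber Y i) (z : N.Fiber Z i) :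
    ∃ w : N.Fiber (fun j => (X j × Y j) × Z j) i,
      x = map (fun _ q => q.1.1) w ∧ y = map (fun _ q => q.1.2) w ∧
        z = map (fun _ q => q.2) w := by
  obtain ⟨p, h1, h2⟩ := exists_two x y
  obtain ⟨w, h3, h4⟩ := exists_two p z
  refine ⟨w, ?_, ?_, h4⟩
  · rw [h1, h3, map_map]
  · rw [h2, h3, map_map]

end Fiber

/-! ### Internal and hyperfinite sets -/

/-- The set of all `x ∈ *X_i` with `x ∈ σ`, for a member `σ` of the extension of the family of
power sets of the `X_j`. -/
def carrier (σ : N.Fiber (fun j => Set (X j)) i) : Set (N.Fiber X i) :=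
  {x | Fiber.Rel (fun _ a s => a ∈ s) x σ}

def IsInternalSet (s : Set (N.Fiber X i)) : Prop := ∃ σ, s = carrier σ

/-- `T` is a hyperfinite set of internal subsets of `*X_i`: its members are those of a member `H`
of the extension of the family of the sets of finite sets of subsets of the `X_j`. -/
def IsHyperfinite (T : Set (Set (N.Fiber X i))) : Prop :=
  ∃ H : N.Fiber (fun j => Finset (Set (X j))) i,
    T = {s | ∃ σ, Fiber.Rel (fun _ s h => s ∈ h) σ H ∧ s = carrier σ}

/-! ### Internal rings -/

variable (N) in
/-- The internal ring `B = *A_i`, a member of the extension of a family `(A_j)` of rings. Since the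
index set and the family are arbitrary, this covers every internal commutative ring. -/
abbrev InternalRing (A : I → Type u) (i : N.obj I) : Type v := N.Fiber A i

variable [∀ j, CommRing (A j)]

noncomputable instance : Add (N.InternalRing A i) := ⟨Fiber.op fun _ a b => a + b⟩

noncomputable instance : Mul (N.InternalRing A i) := ⟨Fiber.op fun _ a b => a * b⟩

instance : Neg (N.InternalRing A i) := ⟨Fiber.map fun _ a => -a⟩

instance : Zero (N.InternalRing A i) := ⟨Fiber.const fun _ => 0⟩

instance : One (N.InternalRing A i) := ⟨Fiber.const fun _ => 1⟩

/-- The ring operations of an internal ring are the extensions of those of the family. -/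
noncomputable instance : CommRing (N.InternalRing A i) where
  nsmul := nsmulRec
  zsmul := zsmulRec
  add_assoc x y z := by
    obtain ⟨w, rfl, rfl, rfl⟩ := Fiber.exists_three x y z
    show Fiber.op _ (Fiber.op _ _ _) _ = Fiber.op _ _ (Fiber.op _ _ _)
    simp only [Fiber.op_map, add_assoc]
  add_comm x y := by
    obtain ⟨w, rfl, rfl⟩ := Fiber.exists_two x y
    show Fiber.op _ _ _ = Fiber.op _ _ _
    simp only [Fiber.op_map, add_comm]
  zero_add x := by
    show Fiber.op _ (Fiber.const _) x = x
    conv_lhs => rw [Fiber.const_eq_map _ x]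
    conv_lhs => arg 3; rw [← Fiber.map_id' x]
    rw [Fiber.op_map]
    simp only [zero_add, Fiber.map_id']
  add_zero x := by
    show Fiber.op _ x (Fiber.const _) = x
    conv_lhs => rw [Fiber.const_eq_map _ x]
    conv_lhs => arg 2; rw [← Fiber.map_id' x]
    rw [Fiber.op_map]
    simp only [add_zero, Fiber.map_id']
  neg_add_cancel x := by
    show Fiber.op _ (Fiber.map _ x) x = Fiber.const _
    conv_lhs => arg 3; rw [← Fiber.map_id' x]
    rw [Fiber.op_map, Fiber.const_eq_map _ x]
    simp only [neg_add_cancel]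
  mul_assoc x y z := by
    obtain ⟨w, rfl, rfl, rfl⟩ := Fiber.exists_three x y z
    show Fiber.op _ (Fiber.op _ _ _) _ = Fiber.op _ _ (Fiber.op _ _ _)
    simp only [Fiber.op_map, mul_assoc]
  mul_comm x y := by
    obtain ⟨w, rfl, rfl⟩ := Fiber.exists_two x y
    show Fiber.op _ _ _ = Fiber.op _ _ _
    simp only [Fiber.op_map, mul_comm]
  one_mul x := by
    show Fiber.op _ (Fiber.const _) x = x
    conv_lhs => rw [Fiber.const_eq_map _ x]
    conv_lhs => arg 3; rw [← Fiber.map_id' x]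
    rw [Fiber.op_map]
    simp only [one_mul, Fiber.map_id']
  mul_one x := by
    show Fiber.op _ x (Fiber.const _) = x
    conv_lhs => rw [Fiber.const_eq_map _ x]
    conv_lhs => arg 2; rw [← Fiber.map_id' x]
    rw [Fiber.op_map]
    simp only [mul_one, Fiber.map_id']
  left_distrib x y z := by
    obtain ⟨w, rfl, rfl, rfl⟩ := Fiber.exists_three x y z
    show Fiber.op _ _ (Fiber.op _ _ _) = Fiber.op _ (Fiber.op _ _ _) (Fiber.op _ _ _)
    simp only [Fiber.op_map, mul_add]
  right_distrib x y z := by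
    obtain ⟨w, rfl, rfl, rfl⟩ := Fiber.exists_three x y z
    show Fiber.op _ (Fiber.op _ _ _) _ = Fiber.op _ (Fiber.op _ _ _) (Fiber.op _ _ _)
    simp only [Fiber.op_map, add_mul]
  zero_mul x := by
    show Fiber.op _ (Fiber.const _) x = Fiber.const _
    conv_lhs => rw [Fiber.const_eq_map _ x]
    conv_lhs => arg 3; rw [← Fiber.map_id' x]
    rw [Fiber.op_map, Fiber.const_eq_map _ x]
    simp only [zero_mul]
  mul_zero x := by
    show Fiber.op _ x (Fiber.const _) = Fiber.const _
    conv_lhs => rw [Fiber.const_eq_map _ x]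
    conv_lhs => arg 2; rw [← Fiber.map_id' x]
    rw [Fiber.op_map, Fiber.const_eq_map _ x]
    simp only [mul_zero]

variable (N A i) in
/-- `B = *A_i` is an internal Dedekind ring: it satisfies the transfer of the definition of a
Dedekind domain, i.e. its index lies in the extension of `{j | A_j is a Dedekind domain}`. -/
def IsInternalDedekind : Prop := i ∈ N.ext {j | IsDedekindDomain (A j)}

/-- The power `x ^ n` of `x ∈ B` with hypernatural exponent `n`. -/
noncomputable def hyperPow (x : N.InternalRing A i) (n : N.HyperNat) : N.InternalRing A i :=
  Fiber.op (fun _ a (k : ULift.{u} ℕ) => a ^ k.down) x (Fiber.ofObj n)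

/-- The `*`-radical of an ideal, internal or not. -/
def starRadical (a : Ideal (N.InternalRing A i)) : Set (N.InternalRing A i) :=
  {x | ∃ n : N.HyperNat, hyperPow x n ∈ a}

def IsStarRadical (a : Ideal (N.InternalRing A i)) : Prop := starRadical a = a

/-- An ideal is internal if it is an internal set. -/
def IsInternal (a : Ideal (N.InternalRing A i)) : Prop :=
  IsInternalSet (a : Set (N.InternalRing A i))

/-! ### Internal maximal ideals, hyperfinite sets of them, and effective Weil divisors -/

variable (N A i) in
/-- The set `M` of internal maximal ideals of `B`. -/
abbrev InternalMax : Type v := {m : Ideal (N.InternalRing A i) // m.IsMaximal ∧ IsInternal m}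

variable (N A i) in
/-- The lattice `L` of hyperfinite subsets of `M`, ordered by inclusion. -/
abbrev HyperfiniteSubsets : Type v :=
  {S : Set (N.InternalMax A i) //
    IsHyperfinite ((fun m : N.InternalMax A i => (m.1 : Set (N.InternalRing A i))) '' S)}

/-- `f : M → *ℕ` is internal: it is the restriction to `M` of a member of the extension of the
family of the sets of functions from the power set of `A_j` to `ℕ`. -/
def IsInternalFun (f : N.InternalMax A i → N.HyperNat) : Prop :=
  ∃ φ : N.Fiber (fun j => Set (A j) → ULift.{u} ℕ) i,
    ∀ (m : N.InternalMax A i) (σ : N.Fiber (fun j => Set (A j)) i),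
      (m.1 : Set (N.InternalRing A i)) = carrier σ →
        f m = Fiber.toObj (Fiber.op (fun _ g s => g s) φ σ)

def divSupport (f : N.InternalMax A i → N.HyperNat) : Set (N.InternalMax A i) :=
  {m | f m ≠ N.natCast 0}

variable (N A i) in
/-- The lattice `*⨁_M *ℕ` of internal functions `M → *ℕ` with hyperfinite support, with the
pointwise order. -/
abbrev EffDivisor : Type v :=
  {f : N.InternalMax A i → N.HyperNat // IsInternalFun f ∧
    IsHyperfinite ((fun m : N.InternalMax A i => (m.1 : Set (N.InternalRing A i))) '' divSupport f)}

/-- The power `p ^ n` of an internal ideal `p` with hypernatural exponent: `p` is a member of the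
extension of the family of the sets of ideals of the `A_j`, and `n`-th powers are extended. -/
def idealHyperPow (p : Ideal (N.InternalRing A i)) (n : N.HyperNat) : Set (N.InternalRing A i) :=
  {x | ∃ J : N.Fiber (fun j => Ideal (A j)) i,
    (p : Set (N.InternalRing A i)) = {y | Fiber.Rel (fun _ a K => a ∈ K) y J} ∧
    Fiber.Rel (fun _ a K => a ∈ K) x
      (Fiber.op (fun _ K (k : ULift.{u} ℕ) => K ^ k.down) J (Fiber.ofObj n))}

/-- `f` is the divisor of the ideal `b`: for each internal maximal ideal `p`, the value `f p` is
the exponent of `p` in `b`, i.e. the largest `n` in `*ℕ` with `b ⊆ p ^ n`. -/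
def IsDivisorOf (f : N.EffDivisor A i) (b : Ideal (N.InternalRing A i)) : Prop :=
  ∀ (p : N.InternalMax A i) (n : N.HyperNat),
    (b : Set (N.InternalRing A i)) ⊆ idealHyperPow p.1 n ↔ n ≤ f.1 p

/-- The filter on `*⨁_M *ℕ` of an ideal `a`: the divisors of the nonzero internal ideals
contained in `a`. -/
def divisorFilter (a : Ideal (N.InternalRing A i)) : Set (N.EffDivisor A i) :=
  {f | ∃ b : Ideal (N.InternalRing A i), IsInternal b ∧ b ≠ ⊥ ∧ b ≤ a ∧ IsDivisorOf f b}

/-- The converse construction: the union of the nonzero internal ideals whose divisor is in a given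
filter. -/
def idealOfFilter (F : Set (N.EffDivisor A i)) : Set (N.InternalRing A i) :=
  {x | ∃ b : Ideal (N.InternalRing A i), IsInternal b ∧ b ≠ ⊥ ∧
    (∃ f ∈ F, IsDivisorOf f b) ∧ x ∈ b}

/-- `Supp F = {supp f | f ∈ F}`. -/
def Supp (F : Set (N.EffDivisor A i)) : Set (N.HyperfiniteSubsets A i) :=
  {S | ∃ f ∈ F, S.1 = divSupport f.1}

open Classical in
/-- The characteristic function of `S ⊆ M`. -/
noncomputable def ch (S : Set (N.InternalMax A i)) : N.InternalMax A i → N.HyperNat :=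
  fun m => if m ∈ S then N.natCast 1 else N.natCast 0

/-- `Ch 𝒮 = {f | ch S ≤ f for some S ∈ 𝒮}`. -/
def Ch (𝒮 : Set (N.HyperfiniteSubsets A i)) : Set (N.EffDivisor A i) :=
  {f | ∃ S ∈ 𝒮, ch S.1 ≤ f.1}

end NonstandardEmbedding

/-! ### Filters on an ordered set -/

section Filters

variable {P : Type*} [Preorder P]

def IsProperFilter (F : Set P) : Prop := Order.IsPFilter F ∧ F ≠ Set.univ

/-- Ultrafilters are the maximal proper filters. -/
def IsUltra (F : Set P) : Prop := Maximal IsProperFilter F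

/-- A filter is principal if it has a least element. -/
def IsPrincipalFilter (F : Set P) : Prop := ∃ x, IsLeast F x

/-- A filter is free if it is not principal. -/
def IsFreeFilter (F : Set P) : Prop := ¬ IsPrincipalFilter F

end Filters

/-! Transfer is used in the style of Łoś. A member `w` of an internal set determines the ultrafilter
of standard properties that it has, and `Holds` commutes with connectives and, through Skolem
functions, with quantifiers. Finitely many internal objects can be written as `Fiber.map f w` for
one common `w`, so a statement about them becomes a pointwise statement about rings `A j` that are
Dedekind domains.

For a nonzero internal ideal `J`, let V(J) be the set of internal maximal ideals containing it. V(J)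
is hyperfinite and is the support of div(J) (`isHyperfinite_zeroLocus`, `divSupport_eq_zeroLocus`).
Conversely, every hyperfinite `S` equals V(J) for the intersection `J` of its members, and `J` is
nonzero because `B` is not a field (`exists_toIdeal_eq_iInf`). Multiplicities therefore disappear:
Supp(Φ(a)) consists of the V(J) with 0 ≠ J ⊆ a, and Ψ(Ch(F)) is `filterIdeal F`, the set of `x`
lying in all members of some S ∈ F.

Two facts make these maps inverse to each other. By an internal Nullstellensatz
(`exists_hyperPow_mem`), an element of every member of V(J) has a hypernatural power in `J`; this
recovers a `*`-radical ideal from its filter. And `J` has two generators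
(`exists_toIdeal_eq_span_sup_span`), so if it lies in `filterIdeal F`, one member of `F` serves both
generators and V(J) ∈ F.

Both maps preserve inclusion, and every maximal ideal, even external, is `*`-radical
(`mem_of_hyperPow_mem_of_isMaximal`); hence maximal ideals correspond to ultrafilters. A least
element `S` of the filter means that `a` is the intersection of `S`, and this is the internal case.
-/

namespace NonstandardEmbedding

/-! ### Łoś's theorem for members of internal sets. -/

section Los

variable {N : NonstandardEmbedding.{u, v}} {I : Type u} {i : N.obj I}
  {W X Y Z : I → Type u}

namespace Fiber

/-- The ultrafilter of the standard properties of a member of `*W_i`. -/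
def uf (w : N.Fiber W i) : Ultrafilter (Σ j, W j) :=
  Ultrafilter.ofComplNotMemIff
    { sets := {s | w.1 ∈ N.ext s}
      univ_sets := by
        show w.1 ∈ N.ext Set.univ
        rw [N.ext_univ]; trivial
      sets_of_superset := fun h hs => N.ext_mono hs h
      inter_sets := fun {s t} hs ht => by
        show w.1 ∈ N.ext (s ∩ t)
        rw [N.ext_inter]; exact ⟨hs, ht⟩ }
    (fun s => by
      show ¬ (w.1 ∈ N.ext sᶜ) ↔ w.1 ∈ N.ext s
      rw [N.ext_compl]; exact not_not)

/-- The extension of a family of predicates. -/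
def Holds (w : N.Fiber W i) (P : ∀ j, W j → Prop) : Prop := ∀ᶠ t in (w.uf : Filter (Σ j, W j)), P t.1 t.2

variable {w : N.Fiber W i} {P Q : ∀ j, W j → Prop}

theorem holds_def : w.Holds P ↔ w.1 ∈ N.ext {t | P t.1 t.2} := Iff.rfl

theorem Holds.mono (h : w.Holds P) (hPQ : ∀ j a, P j a → Q j a) : w.Holds Q :=
  Filter.Eventually.mono h fun t ht => hPQ t.1 t.2 ht

theorem Holds.and (hP : w.Holds P) (hQ : w.Holds Q) : w.Holds fun j a => P j a ∧ Q j a :=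
  Filter.Eventually.and hP hQ

theorem holds_of_forall (h : ∀ j a, P j a) : w.Holds P := Filter.Eventually.of_forall fun _ => h _ _

theorem holds_and : (w.Holds fun j a => P j a ∧ Q j a) ↔ w.Holds P ∧ w.Holds Q :=
  Filter.eventually_and

theorem holds_imp : (w.Holds fun j a => P j a → Q j a) ↔ (w.Holds P → w.Holds Q) :=
  Ultrafilter.eventually_imp

theorem holds_not : (w.Holds fun j a => ¬ P j a) ↔ ¬ w.Holds P := Ultrafilter.eventually_not

theorem holds_congr (h : ∀ j a, P j a ↔ Q j a) : w.Holds P ↔ w.Holds Q :=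
  ⟨fun hP => hP.mono fun j a => (h j a).1, fun hQ => hQ.mono fun j a => (h j a).2⟩

theorem holds_iff (h : w.Holds fun j a => P j a ↔ Q j a) : w.Holds P ↔ w.Holds Q :=
  Filter.eventually_congr h

theorem holds_of_index {p : I → Prop} (h : i ∈ N.ext {j | p j}) : w.Holds fun j _ => p j := by
  rw [holds_def]
  have h1 := N.ext_preimage (Sigma.fst : (Σ j, W j) → I) {j | p j}
  have h2 : w.1 ∈ N.map Sigma.fst ⁻¹' N.ext {j | p j} := by
    rw [Set.mem_preimage, w.2]; exact h
  rw [← h1] at h2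
  exact h2

/-- If the universal statement fails at `w`, choosing a counterexample wherever one exists gives a
single Skolem function `g` that refutes the right-hand side. -/
theorem holds_forall [∀ j, Nonempty (Y j)] {R : ∀ j, W j → Y j → Prop} :
    (w.Holds fun j a => ∀ y, R j a y) ↔ ∀ g : ∀ j, W j → Y j, w.Holds fun j a => R j a (g j a) := by
  refine ⟨fun h g => h.mono fun j a ha => ha _, fun h => ?_⟩
  by_contra hn
  rw [← holds_not] at hn
  classical
  have h1 := h fun j a => if ha : ∃ y, ¬ R j a y then ha.choose else Classical.arbitrary _
  rw [← not_not (a := w.Holds _), ← holds_not] at h1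
  refine h1 (hn.mono fun j a ha => ?_)
  have ha' : ∃ y, ¬ R j a y := not_forall.1 ha
  rw [dif_pos ha']
  exact ha'.choose_spec

theorem holds_exists [∀ j, Nonempty (Y j)] {R : ∀ j, W j → Y j → Prop} :
    (w.Holds fun j a => ∃ y, R j a y) ↔ ∃ g : ∀ j, W j → Y j, w.Holds fun j a => R j a (g j a) := by
  have h := (holds_forall (w := w) (R := fun j a y => ¬ R j a y)).not
  rw [← holds_not, not_forall] at h
  simpa only [not_forall, not_not, holds_not] using h

theorem holds_map (f : ∀ j, W j → X j) {R : ∀ j, X j → Prop} :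
    (map f w).Holds R ↔ w.Holds fun j a => R j (f j a) := by
  have h := N.ext_preimage (fun t : Σ j, W j => (⟨t.1, f t.1 t.2⟩ : Σ j, X j)) {t | R t.1 t.2}
  rw [holds_def, holds_def]
  exact (Set.ext_iff.1 h w.1).symm

theorem rel_iff_holds (R : ∀ j, X j → Y j → Prop) (f : ∀ j, W j → X j) (g : ∀ j, W j → Y j) :
    Rel R (map f w) (map g w) ↔ w.Holds fun j a => R j (f j a) (g j a) := by
  rw [Rel, pair_map]
  exact holds_map (fun j a => (f j a, g j a)) (R := fun j q => R j q.1 q.2)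

theorem map_eq_map_iff (f g : ∀ j, W j → X j) :
    map f w = map g w ↔ w.Holds fun j a => f j a = g j a := by
  have h := N.ext_eq (fun t : Σ j, W j => (⟨t.1, f t.1 t.2⟩ : Σ j, X j))
    (fun t => ⟨t.1, g t.1 t.2⟩)
  refine Subtype.ext_iff.trans ((Set.ext_iff.1 h w.1).symm.trans ?_)
  rw [holds_def]
  have : {t : Σ j, W j | (⟨t.1, f t.1 t.2⟩ : Σ j, X j) = ⟨t.1, g t.1 t.2⟩}
      = {t | f t.1 t.2 = g t.1 t.2} := by
    ext t; simp
  rw [this]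

theorem toObj_ofObj {T : Type u} (t : N.obj T) : toObj (ofObj (i := i) t) = t := by
  rw [toObj, ofObj, ← N.map_comp]
  exact N.map_snd_pair i t

theorem ofObj_toObj {T : Type u} (x : N.Fiber (fun _ : I => T) i) : ofObj (toObj x) = x := by
  apply Subtype.ext
  have h : N.pair i (toObj x) = N.map (fun q : Σ _ : I, T => (q.1, q.2)) x.1 := by
    apply N.pair_unique
    · rw [N.map_fst_pair, ← N.map_comp, x.2]
    · rw [N.map_snd_pair, ← N.map_comp]; rfl
  show N.map _ (N.pair i (toObj x)) = x.1
  rw [h, ← N.map_comp]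
  exact N.map_id _

theorem exists_toObj {T : Type u} (t : N.obj T) :
    ∃ x : N.Fiber (fun _ : I => T) i, t = toObj x := ⟨ofObj t, (toObj_ofObj t).symm⟩

theorem toObj_le_toObj_iff (f g : ∀ j, W j → ULift.{u} ℕ) :
    (show N.HyperNat from toObj (map f w)) ≤ (show N.HyperNat from toObj (map g w)) ↔
      w.Holds fun j a => (f j a).down ≤ (g j a).down := by
  have h := N.ext_preimage (fun t : Σ j, W j => (f t.1 t.2, g t.1 t.2)) {q | q.1.down ≤ q.2.down}
  show N.pair (toObj (map f w)) (toObj (map g w)) ∈ N.ext _ ↔ _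
  rw [toObj, toObj, map, map]
  dsimp only
  rw [← N.map_comp, ← N.map_comp, N.pair_map]
  exact (Set.ext_iff.1 h w.1).symm

theorem toObj_eq_toObj_iff {T : Type u} (f g : ∀ j, W j → T) :
    toObj (map f w) = toObj (map g w) ↔ w.Holds fun j a => f j a = g j a := by
  rw [← map_eq_map_iff]
  refine ⟨fun h => ?_, fun h => by rw [h]⟩
  rw [← ofObj_toObj (map f w), h, ofObj_toObj]

end Fiber

theorem natCast_eq_toObj (k : ℕ) (w : N.Fiber W i) :
    N.natCast k = Fiber.toObj (Fiber.map (fun _ _ => ULift.up k) w) := by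
  have h : N.map (fun _ : Σ j, W j => PUnit.unit) w.1 = N.nonempty_point.some := by
    -- The two projections of `PUnit × PUnit` are the same function, so `*PUnit` has only one point
    -- and the point chosen in `natCast` does not matter.
    have h0 : ∀ p q : N.obj PUnit, p = q := fun p q => by
      obtain ⟨z, h1, h2⟩ := N.exists_pair p q
      have : (Prod.fst : PUnit.{u+1} × PUnit.{u+1} → PUnit) = Prod.snd := rfl
      rw [← h1, ← h2, this]
    exact h0 _ _
  rw [natCast, ← h, ← N.map_comp, Fiber.toObj, Fiber.map, ← N.map_comp]

end Los

variable {N : NonstandardEmbedding.{u, v}} {I : Type u} {i : N.obj I}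
  {W : I → Type u} {A : I → Type u} [∀ j, CommRing (A j)]

open NonstandardEmbedding.Fiber

/-! ### Arithmetic in an internal ring -/

section Arithmetic

variable (w : N.Fiber W i) (f g : ∀ j, W j → A j)

theorem map_add_map : (Fiber.map f w + Fiber.map g w : N.InternalRing A i) = Fiber.map (fun j a => f j a + g j a) w :=
  op_map _ _ _ _

theorem map_mul_map : (Fiber.map f w * Fiber.map g w : N.InternalRing A i) = Fiber.map (fun j a => f j a * g j a) w :=
  op_map _ _ _ _

theorem zero_eq_map : (0 : N.InternalRing A i) = Fiber.map (fun _ _ => 0) w := const_eq_map _ _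

theorem one_eq_map : (1 : N.InternalRing A i) = Fiber.map (fun _ _ => 1) w := const_eq_map _ _

theorem neg_map : (-(Fiber.map f w : N.InternalRing A i)) = Fiber.map (fun j a => -f j a) w := map_map _ _ _

theorem map_sub_map : (Fiber.map f w - Fiber.map g w : N.InternalRing A i) = Fiber.map (fun j a => f j a - g j a) w := by
  rw [sub_eq_add_neg, neg_map, map_add_map]
  simp only [sub_eq_add_neg]

theorem hyperPow_map (n : ∀ j, W j → ULift.{u} ℕ) :
    hyperPow (Fiber.map f w : N.InternalRing A i) (toObj (Fiber.map n w))
      = Fiber.map (fun j a => f j a ^ (n j a).down) w := by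
  show Fiber.op _ _ (ofObj (toObj _)) = _
  rw [ofObj_toObj, op_map]

end Arithmetic

/-! ### Internal ideals -/

/-- The internal ideal given by a member of the extension of the family of sets of ideals. -/
def toIdeal (J : N.Fiber (fun j => Ideal (A j)) i) : Ideal (N.InternalRing A i) where
  carrier := {x | Fiber.Rel (fun _ a K => a ∈ K) x J}
  add_mem' {x y} hx hy := by
    obtain ⟨w, rfl, rfl, rfl⟩ := exists_three x y J
    simp only [Set.mem_ofPred_eq, map_add_map, rel_iff_holds] at *
    exact (hx.and hy).mono fun _ _ h => add_mem h.1 h.2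
  zero_mem' := by
    rw [Set.mem_ofPred_eq, zero_eq_map J, ← map_id' J, map_map, rel_iff_holds]
    exact holds_of_forall fun _ _ => zero_mem _
  smul_mem' c x hx := by
    obtain ⟨w, rfl, rfl, rfl⟩ := exists_three c x J
    simp only [Set.mem_ofPred_eq, smul_eq_mul, map_mul_map, rel_iff_holds] at *
    exact hx.mono fun _ _ h => Ideal.mul_mem_left _ _ h

theorem mem_toIdeal_map {w : N.Fiber W i} {f : ∀ j, W j → A j} {K : ∀ j, W j → Ideal (A j)} :
    (Fiber.map f w : N.InternalRing A i) ∈ toIdeal (Fiber.map K w) ↔ w.Holds fun j a => f j a ∈ K j a :=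
  rel_iff_holds (fun _ a K => a ∈ K) _ _

/-- Elements of the form `Fiber.map f w` suffice to detect inclusion. An arbitrary `x` need not have
this form, so in the other direction `w` is enlarged to a pair with `x`. -/
theorem toIdeal_le_toIdeal {w : N.Fiber W i} {K L : ∀ j, W j → Ideal (A j)} :
    toIdeal (Fiber.map K w) ≤ toIdeal (Fiber.map L w) ↔ w.Holds fun j a => K j a ≤ L j a := by
  constructor
  · intro h
    show w.Holds fun j a => ∀ x, x ∈ K j a → x ∈ L j a
    rw [holds_forall]
    intro f
    rw [holds_imp, ← mem_toIdeal_map, ← mem_toIdeal_map]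
    exact fun hf => h hf
  · intro h x
    obtain ⟨w, rfl, rfl⟩ := exists_two w x
    rw [holds_map] at h
    rw [map_map, map_map, mem_toIdeal_map, mem_toIdeal_map]
    exact fun hx => (hx.and h).mono fun j a h => h.2 h.1

theorem toIdeal_injective :
    Function.Injective (toIdeal : N.Fiber (fun j => Ideal (A j)) i → _) := by
  intro J K h
  obtain ⟨w, rfl, rfl⟩ := exists_two J K
  rw [map_eq_map_iff]
  exact ((toIdeal_le_toIdeal.1 h.le).and (toIdeal_le_toIdeal.1 h.ge)).mono
    fun j a h => le_antisymm h.1 h.2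

theorem toIdeal_bot (w : N.Fiber W i) :
    toIdeal (Fiber.map (fun j _ => (⊥ : Ideal (A j))) w) = ⊥ := by
  rw [eq_bot_iff]
  intro x
  obtain ⟨w, rfl, rfl⟩ := exists_two w x
  rw [map_map, mem_toIdeal_map, Ideal.mem_bot, zero_eq_map w, map_eq_map_iff]
  exact id

theorem toIdeal_eq_bot_iff {w : N.Fiber W i} {K : ∀ j, W j → Ideal (A j)} :
    toIdeal (Fiber.map K w) = ⊥ ↔ w.Holds fun j a => K j a = ⊥ := by
  rw [← toIdeal_bot w, toIdeal_injective.eq_iff, map_eq_map_iff]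

theorem toIdeal_eq_top_iff {w : N.Fiber W i} {K : ∀ j, W j → Ideal (A j)} :
    toIdeal (Fiber.map K w) = ⊤ ↔ w.Holds fun j a => K j a = ⊤ := by
  simp only [Ideal.eq_top_iff_one]
  rw [one_eq_map w, mem_toIdeal_map]

theorem toIdeal_sup (w : N.Fiber W i) (K L : ∀ j, W j → Ideal (A j)) :
    toIdeal (Fiber.map (fun j a => K j a ⊔ L j a) w) = toIdeal (Fiber.map K w) ⊔ toIdeal (Fiber.map L w) := by
  apply le_antisymm
  · intro x
    obtain ⟨w, rfl, rfl⟩ := exists_two w x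
    rw [map_map, map_map, map_map, mem_toIdeal_map]
    intro hx
    simp only [Submodule.mem_sup] at hx
    obtain ⟨f, hf⟩ := holds_exists.1 hx
    simp only [holds_and] at hf
    obtain ⟨g, hg⟩ := holds_exists.1 hf.2
    simp only [holds_and] at hg
    refine Submodule.mem_sup.2 ⟨_, mem_toIdeal_map.2 hf.1, _, mem_toIdeal_map.2 hg.1, ?_⟩
    rw [map_add_map, map_eq_map_iff]
    exact hg.2
  · exact sup_le (toIdeal_le_toIdeal.2 (holds_of_forall fun _ _ => le_sup_left))
      (toIdeal_le_toIdeal.2 (holds_of_forall fun _ _ => le_sup_right))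

theorem toIdeal_span_singleton (w : N.Fiber W i) (f : ∀ j, W j → A j) :
    toIdeal (Fiber.map (fun j a => Ideal.span {f j a}) w) = Ideal.span {(Fiber.map f w : N.InternalRing A i)} := by
  apply le_antisymm
  · intro x
    obtain ⟨w, rfl, rfl⟩ := exists_two w x
    rw [map_map, map_map, mem_toIdeal_map]
    intro hx
    simp only [Ideal.mem_span_singleton'] at hx
    obtain ⟨g, hg⟩ := holds_exists.1 hx
    refine Ideal.mem_span_singleton'.2 ⟨Fiber.map g w, ?_⟩
    rw [map_mul_map, map_eq_map_iff]
    exact hg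
  · rw [Ideal.span_singleton_le_iff_mem, mem_toIdeal_map]
    exact holds_of_forall fun _ _ => Ideal.mem_span_singleton_self _

/-- A first-order form of maximality, quantifying over elements and not over ideals. It makes
maximality among all ideals of `B`, external ones included, amenable to transfer for an internal
ideal. -/
theorem _root_.Ideal.isMaximal_iff_exists_mul_sub_one {R : Type*} [CommRing R] {M : Ideal R} :
    M.IsMaximal ↔ (1 : R) ∉ M ∧ ∀ x, x ∉ M → ∃ y, x * y - 1 ∈ M := by
  refine ⟨fun h => ⟨(Ideal.ne_top_iff_one M).1 h.ne_top, fun x hx => ?_⟩, fun ⟨h1, h⟩ => ?_⟩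
  · obtain ⟨y, m, hm, e⟩ := h.exists_inv hx
    refine ⟨y, ?_⟩
    rw [← e, mul_comm]
    simpa using hm
  · rw [Ideal.isMaximal_iff]
    refine ⟨h1, fun J x hMJ hx hxJ => ?_⟩
    obtain ⟨y, hy⟩ := h x hx
    simpa using J.sub_mem (J.mul_mem_right y hxJ) (hMJ hy)

theorem toIdeal_isMaximal_iff {w : N.Fiber W i} {K : ∀ j, W j → Ideal (A j)} :
    (toIdeal (Fiber.map K w)).IsMaximal ↔ w.Holds fun j a => (K j a).IsMaximal := by
  simp only [Ideal.isMaximal_iff_exists_mul_sub_one]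
  rw [holds_and, holds_not, one_eq_map w, mem_toIdeal_map]
  refine and_congr_right fun _ => ⟨fun h => ?_, fun h x hx => ?_⟩
  · rw [holds_forall]
    intro f
    rw [holds_imp, holds_not, ← mem_toIdeal_map]
    intro hf
    obtain ⟨y, hy⟩ := h _ hf
    obtain ⟨w, rfl, rfl⟩ := exists_two w y
    rw [map_map, map_map, map_mul_map, map_map, map_sub_map, mem_toIdeal_map] at hy
    exact (holds_map _).2 (hy.mono fun j q hq => ⟨_, hq⟩)
  · obtain ⟨w, rfl, rfl⟩ := exists_two w x
    simp only [map_map, mem_toIdeal_map, holds_map] at hx h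
    obtain ⟨g, hg⟩ := holds_exists.1
      (holds_imp.1 (holds_forall.1 h fun j q => q.2) (holds_not.2 hx))
    refine ⟨Fiber.map g w, ?_⟩
    rw [map_map, map_mul_map, map_map, map_sub_map, mem_toIdeal_map]
    exact hg

/-! ### Internal sets and internal ideals -/

theorem mem_carrier_map {X : I → Type u} {w : N.Fiber W i} {f : ∀ j, W j → X j}
    {s : ∀ j, W j → Set (X j)} :
    Fiber.map f w ∈ carrier (Fiber.map s w) ↔ w.Holds fun j a => f j a ∈ s j a :=
  rel_iff_holds (fun _ a s => a ∈ s) _ _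

theorem carrier_map_coe (J : N.Fiber (fun j => Ideal (A j)) i) :
    carrier (Fiber.map (fun j (K : Ideal (A j)) => (K : Set (A j))) J) = (toIdeal J : Set (N.InternalRing A i)) := by
  ext x
  obtain ⟨w, rfl, rfl⟩ := exists_two x J
  rw [map_map, mem_carrier_map, SetLike.mem_coe, mem_toIdeal_map]
  rfl

theorem carrier_injective :
    Function.Injective (carrier : N.Fiber (fun j => Set (A j)) i → Set (N.Fiber A i)) := by
  have key : ∀ σ τ : N.Fiber (fun j => Set (A j)) i, carrier σ = carrier τ →
      Fiber.Rel (fun _ s t => s ⊆ t) σ τ := fun σ τ h => by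
    obtain ⟨w, rfl, rfl⟩ := exists_two σ τ
    rw [rel_iff_holds]
    show w.Holds fun j a => ∀ x, x ∈ _ → x ∈ _
    rw [holds_forall]
    intro f
    rw [holds_imp, ← mem_carrier_map, ← mem_carrier_map, h]
    exact id
  intro σ τ h
  have h1 := key σ τ h
  have h2 := key τ σ h.symm
  obtain ⟨w, rfl, rfl⟩ := exists_two σ τ
  rw [rel_iff_holds] at h1 h2
  rw [map_eq_map_iff]
  exact (h1.and h2).mono fun j a h => h.1.antisymm h.2

/-- The closure properties of an ideal are first-order, so they hold for `s` at `σ`; there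
`Ideal.span s` has carrier `s`, and the extension of `Ideal.span` provides `J`. -/
theorem isInternal_iff_exists_toIdeal {a : Ideal (N.InternalRing A i)} :
    IsInternal a ↔ ∃ J, a = toIdeal J := by
  constructor
  · rintro ⟨σ, hσ⟩
    have hmem : ∀ f : ∀ j, Set (A j) → A j,
        (Fiber.map f σ : N.InternalRing A i) ∈ a ↔ σ.Holds fun j s => f j s ∈ s := fun f => by
      rw [← SetLike.mem_coe, hσ]
      have h := mem_carrier_map (w := σ) (f := f) (s := fun _ s => s)
      rwa [map_id'] at h
    have h0 : σ.Holds fun j s => 0 ∈ s := by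
      rw [← hmem, ← zero_eq_map σ]
      exact zero_mem a
    have h1 : σ.Holds fun j s => ∀ x y, x ∈ s → y ∈ s → x + y ∈ s := by
      simp only [holds_forall]
      intro f g
      rw [holds_imp, holds_imp, ← hmem, ← hmem, ← hmem, ← map_add_map σ]
      exact add_mem
    have h2 : σ.Holds fun j s => ∀ c x, x ∈ s → c * x ∈ s := by
      simp only [holds_forall]
      intro f g
      rw [holds_imp, ← hmem, ← hmem, ← map_mul_map σ]
      exact a.mul_mem_left _
    have h3 : σ.Holds fun j s => ((Ideal.span s : Ideal (A j)) : Set (A j)) = s :=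
      (h0.and (h1.and h2)).mono fun j s h =>
        congrArg SetLike.coe (Ideal.span_eq
          { carrier := s
            zero_mem' := h.1
            add_mem' := fun {x y} => h.2.1 x y
            smul_mem' := h.2.2 })
    refine ⟨Fiber.map (fun j s => Ideal.span s) σ, SetLike.coe_injective ?_⟩
    rw [← carrier_map_coe, map_map, hσ]
    congr 1
    conv_lhs => rw [← map_id' σ]
    rw [map_eq_map_iff]
    exact h3.mono fun j s h => h.symm
  · rintro ⟨J, rfl⟩
    exact ⟨_, (carrier_map_coe J).symm⟩

theorem isInternal_toIdeal (J : N.Fiber (fun j => Ideal (A j)) i) : IsInternal (toIdeal J) :=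
  isInternal_iff_exists_toIdeal.2 ⟨J, rfl⟩

theorem mem_ext_not_isField (h : ¬ IsField (N.InternalRing A i)) :
    i ∈ N.ext {j | ¬ IsField (A j)} := by
  have h1 := N.ext_compl {j | IsField (A j)}
  by_contra hn
  have h2 : i ∈ N.ext {j | IsField (A j)} := by
    by_contra h3
    exact hn (h1.ge h3)
  let w : N.Fiber (fun _ => PUnit) i := Fiber.const fun _ => PUnit.unit
  -- Being a field is transferred as maximality of the zero ideal.
  have h3 : (⊥ : Ideal (N.InternalRing A i)).IsMaximal := by
    rw [← toIdeal_bot w, toIdeal_isMaximal_iff]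
    refine (holds_of_index h2).mono fun j _ hj => ?_
    have := hj.nontrivial
    exact Ring.isField_iff_maximal_bot.1 hj
  have : Nontrivial (N.InternalRing A i) := ⟨0, 1, fun h01 =>
    h3.ne_top ((Ideal.eq_top_iff_one _).2 (by rw [← h01]; exact zero_mem _))⟩
  exact h (Ring.isField_iff_maximal_bot.2 h3)

/-! ### Hyperfinite sets of internal maximal ideals -/

theorem InternalMax.exists_toIdeal (m : N.InternalMax A i) : ∃ J, m.1 = toIdeal J :=
  isInternal_iff_exists_toIdeal.1 m.2.2

theorem mem_iff_rel_of_image_eq {S : Set (N.InternalMax A i)}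
    {H : N.Fiber (fun j => Finset (Set (A j))) i}
    (hH : (fun m : N.InternalMax A i => (m.1 : Set (N.InternalRing A i))) '' S
      = {s | ∃ σ, Fiber.Rel (fun _ s h => s ∈ h) σ H ∧ s = carrier σ})
    (m : N.InternalMax A i) {J : N.Fiber (fun j => Ideal (A j)) i} (hJ : m.1 = toIdeal J) :
    m ∈ S ↔ Fiber.Rel (fun _ s h => s ∈ h) (Fiber.map (fun j (K : Ideal (A j)) => (K : Set (A j))) J) H := by
  have h1 : m ∈ S ↔ (m.1 : Set (N.InternalRing A i)) ∈
      (fun m : N.InternalMax A i => (m.1 : Set (N.InternalRing A i))) '' S :=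
    ⟨fun h => ⟨m, h, rfl⟩, fun ⟨m', h, e⟩ => by
      rwa [← Subtype.ext (SetLike.coe_injective e)]⟩
  rw [h1, hH, hJ, ← carrier_map_coe]
  exact ⟨fun ⟨σ, h, e⟩ => by rwa [carrier_injective e], fun h => ⟨_, h, rfl⟩⟩

/-- A Skolem function `g` selecting a member of each finite set yields an internal member of the
hyperfinite set, hence an internal maximal ideal. -/
theorem holds_mem_isMaximal_of_image_eq {S : Set (N.InternalMax A i)}
    {H : N.Fiber (fun j => Finset (Set (A j))) i}
    (hH : (fun m : N.InternalMax A i => (m.1 : Set (N.InternalRing A i))) '' S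
      = {s | ∃ σ, Fiber.Rel (fun _ s h => s ∈ h) σ H ∧ s = carrier σ}) :
    H.Holds fun j h => ∀ s ∈ h, ∃ P : Ideal (A j), P.IsMaximal ∧ s = P := by
  rw [holds_forall]
  intro g
  rw [holds_imp]
  intro hg
  have h1 : carrier (Fiber.map g H) ∈
      (fun m : N.InternalMax A i => (m.1 : Set (N.InternalRing A i))) '' S := by
    rw [hH]
    refine ⟨_, ?_, rfl⟩
    have := (rel_iff_holds (w := H) (fun _ s (h : Finset (Set _)) => s ∈ h) g (fun _ h => h)).2 hg
    rwa [map_id'] at this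
  obtain ⟨m, -, hm⟩ := h1
  obtain ⟨J, hJ⟩ := m.exists_toIdeal
  have hmax := m.2.1
  dsimp only at hm
  rw [hJ] at hm hmax
  rw [← carrier_map_coe] at hm
  have h2 := carrier_injective hm
  obtain ⟨w, rfl, rfl⟩ := exists_two H J
  rw [map_map, map_map, map_eq_map_iff] at h2
  rw [toIdeal_isMaximal_iff] at hmax
  exact (holds_map _).2 ((hmax.and h2).mono fun j q hq => ⟨q.2, hq.1, hq.2.symm⟩)

/-- The internal maximal ideals containing a nonzero internal ideal form a hyperfinite set. -/
theorem isHyperfinite_zeroLocus (hB : N.IsInternalDedekind A i)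
    {J : N.Fiber (fun j => Ideal (A j)) i} (hJ : toIdeal J ≠ ⊥) :
    IsHyperfinite ((fun m : N.InternalMax A i => (m.1 : Set (N.InternalRing A i))) ''
      {m | toIdeal J ≤ m.1}) := by
  classical
  let F : ∀ j, Ideal (A j) → Set (Set (A j)) := fun j K =>
    {s | ∃ P : Ideal (A j), P.IsMaximal ∧ K ≤ P ∧ s = P}
  -- The maximal ideals over a nonzero ideal are among its finitely many prime factors.
  have hF : ∀ j (K : Ideal (A j)), IsDedekindDomain (A j) → K ≠ ⊥ → (F j K).Finite := by
    intro j K hj hK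
    refine ((Ideal.finite_factors hK).image
      fun v : IsDedekindDomain.HeightOneSpectrum (A j) => (v.asIdeal : Set (A j))).subset ?_
    rintro _ ⟨P, hP, hKP, rfl⟩
    exact ⟨⟨P, hP.isPrime, fun h => hK (le_bot_iff.1 (h ▸ hKP))⟩, Ideal.dvd_iff_le.2 hKP, rfl⟩
  -- The default `∅` never matters: at `J` the ring is Dedekind and the ideal is nonzero.
  refine ⟨Fiber.map (fun j K => if h : (F j K).Finite then h.toFinset else ∅) J, ?_⟩
  ext s
  have key : ∀ σ : N.Fiber (fun j => Set (A j)) i, Fiber.Rel (fun _ s h => s ∈ h) σ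
      (Fiber.map (fun j K => if h : (F j K).Finite then h.toFinset else ∅) J) ↔
      Fiber.Rel (fun j s K => s ∈ F j K) σ J := by
    intro σ
    obtain ⟨w, rfl, rfl⟩ := exists_two σ J
    rw [map_map, rel_iff_holds, rel_iff_holds]
    rw [Ne, toIdeal_eq_bot_iff, ← holds_not] at hJ
    refine holds_iff ((hJ.and (holds_of_index hB)).mono fun j q hq => ?_)
    rw [dif_pos (hF j q.2 hq.2 hq.1), Set.Finite.mem_toFinset]
  constructor
  · rintro ⟨m, hm, rfl⟩
    obtain ⟨P, hP⟩ := m.exists_toIdeal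
    have hmax := m.2.1
    rw [Set.mem_ofPred_eq] at hm
    rw [hP] at hm hmax
    refine ⟨_, ?_, (congrArg _ hP).trans (carrier_map_coe P).symm⟩
    rw [key]
    obtain ⟨w, rfl, rfl⟩ := exists_two J P
    rw [map_map, rel_iff_holds]
    rw [toIdeal_isMaximal_iff] at hmax
    rw [toIdeal_le_toIdeal] at hm
    exact (hmax.and hm).mono fun j q hq => ⟨_, hq.1, hq.2, rfl⟩
  · rintro ⟨σ, hσ, rfl⟩
    rw [key] at hσ
    obtain ⟨w, rfl, rfl⟩ := exists_two σ J
    rw [rel_iff_holds] at hσ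
    obtain ⟨g, hg⟩ := holds_exists.1 hσ
    simp only [holds_and] at hg
    refine ⟨⟨toIdeal (Fiber.map g w), toIdeal_isMaximal_iff.2 hg.1, isInternal_toIdeal _⟩,
      toIdeal_le_toIdeal.2 hg.2.1, ?_⟩
    dsimp only
    rw [← carrier_map_coe, map_map, (map_eq_map_iff _ _).2 hg.2.2]

/-- A hyperfinite set of internal maximal ideals is the zero locus of its intersection, which is
internal and nonzero. -/
theorem exists_toIdeal_eq_iInf (hB : N.IsInternalDedekind A i)
    (hfield : ¬ IsField (N.InternalRing A i)) (S : N.HyperfiniteSubsets A i) :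
    ∃ J : N.Fiber (fun j => Ideal (A j)) i, toIdeal J ≠ ⊥ ∧
      (∀ x, x ∈ toIdeal J ↔ ∀ m ∈ S.1, x ∈ m.1) ∧
      ∀ m : N.InternalMax A i, toIdeal J ≤ m.1 → m ∈ S.1 := by
  obtain ⟨H, hH⟩ := S.2
  have hmax := holds_mem_isMaximal_of_image_eq hH
  have hmem := mem_iff_rel_of_image_eq hH
  refine ⟨Fiber.map (fun j h => h.inf Ideal.span) H, ?_, fun x => ⟨fun hx m hm => ?_, fun hx => ?_⟩,
    fun m hm => ?_⟩
  · rw [Ne, toIdeal_eq_bot_iff, ← holds_not]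
    refine ((hmax.and (holds_of_index hB)).and (holds_of_index (mem_ext_not_isField hfield))).mono ?_
    rintro j h ⟨⟨h1, h2⟩, h3⟩ h4
    -- Zero is a prime ideal, so a vanishing finite intersection forces one of the maximal ideals to
    -- be zero, and `A j` would be a field.
    obtain ⟨s, hs, h5⟩ := (Ideal.isPrime_bot (α := A j)).inf_le'.1 h4.le
    obtain ⟨P, hP, rfl⟩ := h1 s hs
    rw [Ideal.span_eq, le_bot_iff] at h5
    subst h5
    exact h3 (Ring.isField_iff_maximal_bot.2 hP)
  · obtain ⟨P, hP⟩ := m.exists_toIdeal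
    rw [hmem m hP] at hm
    rw [hP]
    obtain ⟨w, rfl, rfl, rfl⟩ := exists_three H P x
    rw [map_map, rel_iff_holds] at hm
    rw [map_map, mem_toIdeal_map] at hx
    rw [mem_toIdeal_map]
    refine (hm.and hx).mono fun j q hq => ?_
    have := Finset.inf_le (f := Ideal.span) hq.1 hq.2
    rwa [Ideal.span_eq] at this
  · obtain ⟨w, rfl, rfl⟩ := exists_two H x
    rw [holds_map] at hmax
    rw [map_map, mem_toIdeal_map]
    -- The hypothesis on `x` concerns actual points of `S`; each selection `g` from the finite sets
    -- is realised by such a point.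
    have : w.Holds fun j q => ∀ s ∈ q.1, q.2 ∈ Ideal.span s := by
      rw [holds_forall]
      intro g
      rw [holds_imp]
      intro hg
      obtain ⟨P, hP⟩ := holds_exists.1 ((hmax.and hg).mono fun j q hq => hq.1 _ hq.2)
      simp only [holds_and] at hP
      have h1 := hx ⟨toIdeal (Fiber.map P w), toIdeal_isMaximal_iff.2 hP.1, isInternal_toIdeal _⟩ (by
        rw [hmem _ rfl, map_map, rel_iff_holds]
        exact (hg.and hP.2).mono fun j q hq => hq.2 ▸ hq.1)
      rw [mem_toIdeal_map] at h1
      exact (h1.and hP.2).mono fun j q hq => by rw [hq.2]; exact Ideal.subset_span hq.1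
    refine this.mono fun j q hq => ?_
    rw [Submodule.mem_finsetInf]
    exact hq
  · obtain ⟨P, hP⟩ := m.exists_toIdeal
    have hPm := m.2.1
    rw [hmem m hP]
    rw [hP] at hm hPm
    obtain ⟨w, rfl, rfl⟩ := exists_two H P
    rw [map_map, rel_iff_holds]
    rw [map_map, toIdeal_le_toIdeal] at hm
    rw [toIdeal_isMaximal_iff] at hPm
    rw [holds_map] at hmax
    refine ((hm.and hPm).and hmax).mono ?_
    rintro j ⟨h, Q⟩ ⟨⟨h1, h2⟩, h3⟩
    -- A prime containing a finite intersection contains one of its terms, and maximality of that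
    -- term gives equality.
    obtain ⟨s, hs, h5⟩ := h2.isPrime.inf_le'.1 h1
    obtain ⟨P, hP, rfl⟩ := h3 s hs
    rw [Ideal.span_eq] at h5
    rwa [← hP.eq_of_le h2.ne_top h5]

/-! ### Divisors -/

theorem coe_eq_ofPred_rel_iff {J K : N.Fiber (fun j => Ideal (A j)) i} :
    (toIdeal J : Set (N.InternalRing A i)) = {y | Fiber.Rel (fun _ a K => a ∈ K) y K} ↔ J = K :=
  ⟨fun h => toIdeal_injective (SetLike.coe_injective h), fun h => by rw [h]; rfl⟩

theorem idealHyperPow_toIdeal_map (w : N.Fiber W i) (P : ∀ j, W j → Ideal (A j))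
    (n : ∀ j, W j → ULift.{u} ℕ) :
    idealHyperPow (toIdeal (Fiber.map P w)) (toObj (Fiber.map n w))
      = (toIdeal (Fiber.map (fun j a => P j a ^ (n j a).down) w) : Set (N.InternalRing A i)) := by
  have h : Fiber.op (fun _ K (k : ULift.{u} ℕ) => K ^ k.down) (Fiber.map P w)
      (ofObj (toObj (Fiber.map n w))) = Fiber.map (fun j a => P j a ^ (n j a).down) w := by
    rw [ofObj_toObj, op_map]
  rw [← h]
  ext x
  constructor
  · rintro ⟨J, hJ, hx⟩
    rw [coe_eq_ofPred_rel_iff] at hJ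
    rw [hJ]
    exact hx
  · intro hx
    exact ⟨_, rfl, hx⟩

theorem HyperNat.ne_zero_iff_one_le (i : N.obj I) (n : N.HyperNat) :
    n ≠ N.natCast 0 ↔ N.natCast 1 ≤ n := by
  obtain ⟨n, rfl⟩ := exists_toObj (i := i) n
  rw [natCast_eq_toObj 0 n, natCast_eq_toObj 1 n]
  have e := map_id' n
  rw [← e, map_map, map_map]
  refine Iff.trans ?_ (toObj_le_toObj_iff (fun _ _ => ULift.up 1) (fun _ k => k)).symm
  refine (toObj_eq_toObj_iff _ _).not.trans ?_
  rw [← holds_not]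
  refine holds_congr fun j k => ?_
  rw [ULift.ext_iff]
  exact Nat.one_le_iff_ne_zero.symm

theorem HyperNat.zero_le (i : N.obj I) (n : N.HyperNat) : N.natCast 0 ≤ n := by
  obtain ⟨n, rfl⟩ := exists_toObj (i := i) n
  rw [natCast_eq_toObj 0 n]
  have e := map_id' n
  rw [← e, map_map]
  exact (toObj_le_toObj_iff (fun _ _ => ULift.up 0) (fun _ k => k)).2
    (holds_of_forall fun _ _ => Nat.zero_le _)

/-- A nonzero hypernatural is at least 1, so the defining property of a divisor is only needed at
exponent 1. -/
theorem divSupport_eq_zeroLocus {f : N.InternalMax A i → N.HyperNat}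
    {b : Ideal (N.InternalRing A i)} (h : ∀ (p : N.InternalMax A i) (n : N.HyperNat),
      (b : Set (N.InternalRing A i)) ⊆ idealHyperPow p.1 n ↔ n ≤ f p) :
    divSupport f = {m | b ≤ m.1} := by
  ext p
  show f p ≠ N.natCast 0 ↔ b ≤ p.1
  obtain ⟨P, hP⟩ := p.exists_toIdeal
  rw [HyperNat.ne_zero_iff_one_le i, ← h, hP, ← map_id' P, natCast_eq_toObj 1 P, idealHyperPow_toIdeal_map]
  simp only [pow_one, SetLike.coe_subset_coe]

/-- The divisor is the extension of `multiplicity`, which is finite for a nonzero ideal and a proper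
prime. -/
theorem exists_isDivisorOf (hB : N.IsInternalDedekind A i)
    {J : N.Fiber (fun j => Ideal (A j)) i} (hJ : toIdeal J ≠ ⊥) :
    ∃ f : N.EffDivisor A i, IsDivisorOf f (toIdeal J) := by
  choose idx hidx using InternalMax.exists_toIdeal (N := N) (A := A) (i := i)
  let f : N.InternalMax A i → N.HyperNat := fun m =>
    toObj (Fiber.op (fun _ P K => ULift.up (multiplicity P K)) (idx m) J)
  have hle : ∀ (p : N.InternalMax A i) (n : N.HyperNat),
      (toIdeal J : Set (N.InternalRing A i)) ⊆ idealHyperPow p.1 n ↔ n ≤ f p := by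
    intro p n
    obtain ⟨n, rfl⟩ := exists_toObj (i := i) n
    have hp := p.2.1
    dsimp only [f]
    rw [hidx p] at hp ⊢
    generalize idx p = P at *
    obtain ⟨w, rfl, rfl, rfl⟩ := exists_three J P n
    rw [idealHyperPow_toIdeal_map, SetLike.coe_subset_coe, toIdeal_le_toIdeal, op_map]
    refine Iff.trans ?_ (toObj_le_toObj_iff _ _).symm
    rw [Ne, toIdeal_eq_bot_iff, ← holds_not] at hJ
    rw [toIdeal_isMaximal_iff] at hp
    refine holds_iff (((hJ.and hp).and (holds_of_index hB)).mono ?_)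
    rintro j ⟨⟨K, P⟩, n⟩ ⟨⟨h1, h2⟩, h3⟩
    have h4 : FiniteMultiplicity P K := FiniteMultiplicity.of_not_isUnit
      (by rw [Ideal.isUnit_iff]; exact h2.ne_top) h1
    rw [← Ideal.dvd_iff_le, h4.pow_dvd_iff_le_multiplicity]
  -- An internal function is represented on all subsets of `A j`; `Ideal.span` returns the ideal
  -- when the subset is one.
  refine ⟨⟨f, ⟨Fiber.map (fun j K s => ULift.up (multiplicity (Ideal.span s) K)) J, ?_⟩, ?_⟩, hle⟩
  · intro m σ hσ
    rw [hidx m, ← carrier_map_coe] at hσ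
    rw [← carrier_injective hσ]
    dsimp only [f]
    generalize idx m = P
    obtain ⟨w, rfl, rfl⟩ := exists_two J P
    rw [map_map, map_map, op_map, op_map]
    simp only [Ideal.span_eq]
    rfl
  · rw [divSupport_eq_zeroLocus hle]
    exact isHyperfinite_zeroLocus hB hJ

/-! ### Transfer of facts about Dedekind domains -/

theorem hyperPow_one (x : N.InternalRing A i) : hyperPow x (N.natCast 1) = x := by
  rw [natCast_eq_toObj 1 x]
  conv_lhs => rw [← map_id' x, map_map]
  rw [hyperPow_map]
  simp only [pow_one]
  exact map_id' x

theorem InternalMax.mem_of_hyperPow_mem (m : N.InternalMax A i) {x : N.InternalRing A i}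
    {n : N.HyperNat} (h : hyperPow x n ∈ m.1) : x ∈ m.1 := by
  obtain ⟨P, hP⟩ := m.exists_toIdeal
  have hmax := m.2.1
  rw [hP] at h hmax ⊢
  obtain ⟨n, rfl⟩ := exists_toObj (i := i) n
  obtain ⟨w, rfl, rfl, rfl⟩ := exists_three P x n
  rw [hyperPow_map, mem_toIdeal_map] at h
  rw [toIdeal_isMaximal_iff] at hmax
  rw [mem_toIdeal_map]
  exact (h.and hmax).mono fun j q hq => hq.2.isPrime.mem_of_pow_mem _ hq.1

/-- An external maximal ideal contains `x` as soon as it contains a hypernatural power of `x`. -/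
theorem mem_of_hyperPow_mem_of_isMaximal {M : Ideal (N.InternalRing A i)} (hM : M.IsMaximal)
    {x : N.InternalRing A i} {n : N.HyperNat} (h : hyperPow x n ∈ M) : x ∈ M := by
  by_contra hx
  obtain ⟨y, hy⟩ := (Ideal.isMaximal_iff_exists_mul_sub_one.1 hM).2 x hx
  obtain ⟨n, rfl⟩ := exists_toObj (i := i) n
  -- Transfer does not apply to `M`, which may be external. It does apply to the principal ideal of
  -- `x * y - 1`, which is internal and contained in `M`: t - 1 divides t ^ n - 1 with t = xy.
  have key : hyperPow x (toObj n) * hyperPow y (toObj n) - 1 ∈ Ideal.span {x * y - 1} := by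
    obtain ⟨w, rfl, rfl, rfl⟩ := exists_three x y n
    rw [hyperPow_map, hyperPow_map, map_mul_map, map_mul_map, one_eq_map w, map_sub_map,
      map_sub_map, ← toIdeal_span_singleton, mem_toIdeal_map]
    refine holds_of_forall fun j q => ?_
    rw [← mul_pow, Ideal.mem_span_singleton]
    exact sub_one_dvd_pow_sub_one _ _
  have h1 := (Ideal.span_singleton_le_iff_mem _).2 hy key
  refine (Ideal.ne_top_iff_one M).1 hM.ne_top ?_
  simpa using M.sub_mem (M.mul_mem_right (hyperPow y (toObj n)) h) h1

/-- Fibrewise, the radical is the intersection of the primes above the ideal, and these are nonzero,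
hence maximal. The exponent varies with the fibre, so it is only hypernatural. -/
theorem exists_hyperPow_mem (hB : N.IsInternalDedekind A i)
    {J : N.Fiber (fun j => Ideal (A j)) i} (hJ : toIdeal J ≠ ⊥) {x : N.InternalRing A i}
    (hx : ∀ m : N.InternalMax A i, toIdeal J ≤ m.1 → x ∈ m.1) :
    ∃ n : N.HyperNat, hyperPow x n ∈ toIdeal J := by
  obtain ⟨w, rfl, rfl⟩ := exists_two J x
  rw [Ne, toIdeal_eq_bot_iff, ← holds_not] at hJ
  have h1 : w.Holds fun j q => ∀ P : Ideal (A j), P.IsMaximal → q.1 ≤ P → q.2 ∈ P := by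
    rw [holds_forall]
    intro P
    rw [holds_imp, holds_imp]
    intro h2 h3
    have := hx ⟨toIdeal (Fiber.map P w), toIdeal_isMaximal_iff.2 h2, isInternal_toIdeal _⟩
      (toIdeal_le_toIdeal.2 h3)
    rwa [mem_toIdeal_map] at this
  have h2 : w.Holds fun j q => ∃ k : ULift.{u} ℕ, q.2 ^ k.down ∈ q.1 := by
    refine ((h1.and hJ).and (holds_of_index hB)).mono ?_
    rintro j ⟨K, x⟩ ⟨⟨h3, h4⟩, h5⟩
    have h6 : x ∈ K.radical := by
      rw [Ideal.radical_eq_sInf, Ideal.mem_sInf]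
      rintro P ⟨hKP, hP⟩
      have hP0 : P ≠ ⊥ := fun h => h4 (le_bot_iff.1 (h ▸ hKP))
      exact h3 P (hP.isMaximal hP0) hKP
    obtain ⟨k, hk⟩ := h6
    exact ⟨⟨k⟩, hk⟩
  obtain ⟨n, hn⟩ := holds_exists.1 h2
  refine ⟨toObj (Fiber.map n w), ?_⟩
  rw [hyperPow_map, mem_toIdeal_map]
  exact hn

/-- Internal ideals of an internal Dedekind ring are generated by two elements. -/
theorem exists_toIdeal_eq_span_sup_span (hB : N.IsInternalDedekind A i)
    (J : N.Fiber (fun j => Ideal (A j)) i) :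
    ∃ x y : N.InternalRing A i, toIdeal J = Ideal.span {x} ⊔ Ideal.span {y} := by
  have h : J.Holds fun j K => ∃ q : A j × A j, K = Ideal.span {q.1} ⊔ Ideal.span {q.2} := by
    refine (holds_of_index hB).mono fun j K hj => ?_
    by_cases hK : K = ⊥
    · exact ⟨(0, 0), by simp [hK]⟩
    · obtain ⟨x, hx, hx0⟩ := Submodule.exists_mem_ne_zero_of_ne_bot hK
      obtain ⟨y, hy⟩ := IsDedekindDomain.exists_eq_span_pair hx hx0
      exact ⟨(x, y), by rw [hy, ← Ideal.span_union]; rfl⟩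
  obtain ⟨g, hg⟩ := holds_exists.1 h
  refine ⟨Fiber.map (fun j K => (g j K).1) J, Fiber.map (fun j K => (g j K).2) J, ?_⟩
  rw [← toIdeal_span_singleton, ← toIdeal_span_singleton, ← toIdeal_sup]
  congr 1
  conv_lhs => rw [← map_id' J]
  rw [map_eq_map_iff]
  exact hg

theorem exists_internalMax_of_ne_top {J : N.Fiber (fun j => Ideal (A j)) i} (hJ : toIdeal J ≠ ⊤) :
    ∃ m : N.InternalMax A i, toIdeal J ≤ m.1 := by
  rw [← map_id' J, Ne, toIdeal_eq_top_iff, ← holds_not] at hJ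
  obtain ⟨P, hP⟩ := holds_exists.1 (hJ.mono fun j K hK => Ideal.exists_le_maximal K hK)
  rw [holds_and] at hP
  refine ⟨⟨toIdeal (Fiber.map P J), toIdeal_isMaximal_iff.2 hP.1, isInternal_toIdeal _⟩, ?_⟩
  conv_lhs => rw [← map_id' J]
  exact toIdeal_le_toIdeal.2 hP.2

theorem exists_toIdeal_eq_span_singleton (x : N.InternalRing A i) :
    ∃ J : N.Fiber (fun j => Ideal (A j)) i, toIdeal J = Ideal.span {x} :=
  ⟨_, (toIdeal_span_singleton x fun _ a => a).trans (by rw [map_id'])⟩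

/-! ### The filter of an ideal and the ideal of a filter -/

/-- The zero locus of a nonzero internal ideal, as a hyperfinite set. -/
def zeroLocus (hB : N.IsInternalDedekind A i) (J : N.Fiber (fun j => Ideal (A j)) i)
    (hJ : toIdeal J ≠ ⊥) : N.HyperfiniteSubsets A i :=
  ⟨{m | toIdeal J ≤ m.1}, isHyperfinite_zeroLocus hB hJ⟩

theorem mem_supp_divisorFilter_iff (hB : N.IsInternalDedekind A i)
    {a : Ideal (N.InternalRing A i)} {S : N.HyperfiniteSubsets A i} :
    S ∈ Supp (divisorFilter a) ↔ ∃ J, ∃ hJ : toIdeal J ≠ ⊥, toIdeal J ≤ a ∧ S = zeroLocus hB J hJ := by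
  constructor
  · rintro ⟨f, ⟨b, hb, hb0, hba, hf⟩, hS⟩
    obtain ⟨J, rfl⟩ := isInternal_iff_exists_toIdeal.1 hb
    exact ⟨J, hb0, hba, Subtype.ext (hS.trans (divSupport_eq_zeroLocus hf))⟩
  · rintro ⟨J, hJ, hJa, rfl⟩
    obtain ⟨f, hf⟩ := exists_isDivisorOf hB hJ
    exact ⟨f, ⟨_, isInternal_toIdeal J, hJ, hJa, hf⟩, (divSupport_eq_zeroLocus hf).symm⟩

theorem isHyperfinite_empty {X : I → Type u} : IsHyperfinite (∅ : Set (Set (N.Fiber X i))) := by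
  refine ⟨Fiber.const fun _ => ∅, (Set.eq_empty_of_forall_notMem ?_).symm⟩
  rintro s ⟨σ, hσ, -⟩
  rw [const_eq_map _ σ, ← map_id' σ, map_map, rel_iff_holds] at hσ
  simp only [Finset.notMem_empty] at hσ
  exact (holds_not.1 (holds_of_forall (w := σ) fun _ _ => not_false)) hσ

theorem isHyperfinite_image_empty : IsHyperfinite
    ((fun m : N.InternalMax A i => (m.1 : Set (N.InternalRing A i))) '' ∅) := by
  rw [Set.image_empty]
  exact isHyperfinite_empty

/-- Having a divisor above ch(S) means being contained in every member of `S`, and the intersection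
of `S` is the largest such internal ideal. -/
theorem mem_idealOfFilter_ch_iff (hB : N.IsInternalDedekind A i) (hfield : ¬ IsField (N.InternalRing A i))
    {F : Set (N.HyperfiniteSubsets A i)} {x : N.InternalRing A i} :
    x ∈ idealOfFilter (Ch F) ↔ ∃ S ∈ F, ∀ m ∈ S.1, x ∈ m.1 := by
  constructor
  · rintro ⟨b, -, -, ⟨f, ⟨S, hS, hSf⟩, hf⟩, hx⟩
    refine ⟨S, hS, fun m hm => ?_⟩
    have h1 := hSf m
    rw [ch, if_pos hm, ← HyperNat.ne_zero_iff_one_le i] at h1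
    exact (divSupport_eq_zeroLocus hf).le h1 hx
  · rintro ⟨S, hS, hx⟩
    obtain ⟨J, hJ, hJS, -⟩ := exists_toIdeal_eq_iInf hB hfield S
    obtain ⟨f, hf⟩ := exists_isDivisorOf hB hJ
    refine ⟨_, isInternal_toIdeal J, hJ, ⟨f, ⟨S, hS, fun m => ?_⟩, hf⟩, (hJS x).2 hx⟩
    rw [ch]
    split_ifs with hm
    · rw [← HyperNat.ne_zero_iff_one_le i]
      exact (divSupport_eq_zeroLocus hf).ge fun y hy => (hJS y).1 hy m hm
    · exact HyperNat.zero_le i _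

theorem isProperFilter_supp_divisorFilter (hB : N.IsInternalDedekind A i) (hfield : ¬ IsField (N.InternalRing A i))
    {a : Ideal (N.InternalRing A i)} (ha : a ≠ ⊤)
    (ha0 : a ≠ ⊥) (har : IsStarRadical a) : IsProperFilter (Supp (divisorFilter a)) := by
  have hmem := fun S => mem_supp_divisorFilter_iff hB (a := a) (S := S)
  refine ⟨Order.IsPFilter.of_def ?_ ?_ ?_, fun h => ?_⟩
  · obtain ⟨x, hx, hx0⟩ := Submodule.exists_mem_ne_zero_of_ne_bot ha0
    obtain ⟨J, hJ⟩ := exists_toIdeal_eq_span_singleton x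
    refine ⟨_, (hmem _).2 ⟨J, ?_, ?_, rfl⟩⟩
    · rwa [hJ, Ne, Ideal.span_singleton_eq_bot]
    · rwa [hJ, Ideal.span_singleton_le_iff_mem]
  · intro S hS T hT
    obtain ⟨J, hJ, hJa, rfl⟩ := (hmem _).1 hS
    obtain ⟨K, hK, hKa, rfl⟩ := (hmem _).1 hT
    obtain ⟨w, rfl, rfl⟩ := exists_two J K
    -- Directedness: V(J + K) lies in both V(J) and V(K).
    have h := toIdeal_sup w (fun _ q => q.1) (fun _ q => q.2)
    refine ⟨_, (hmem _).2 ⟨_, fun h0 => hJ ?_, h.le.trans (sup_le hJa hKa), rfl⟩, ?_, ?_⟩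
    · exact (sup_eq_bot_iff.1 (h.symm.trans h0)).1
    · exact fun m hm => le_sup_left.trans (h.ge.trans hm)
    · exact fun m hm => le_sup_right.trans (h.ge.trans hm)
  · intro S T hST hS
    obtain ⟨J, hJ, hJa, rfl⟩ := (hmem _).1 hS
    -- Upward closure: if V(J) ⊆ T, the intersection `K` of `T` lies in the `*`-radical of `J`,
    -- hence in `a`, and V(K) = T.
    obtain ⟨K, hK, hKT, hKT'⟩ := exists_toIdeal_eq_iInf hB hfield T
    refine (hmem _).2 ⟨K, hK, fun x hx => ?_, Subtype.ext ?_⟩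
    · obtain ⟨n, hn⟩ := exists_hyperPow_mem hB hJ fun m hm => (hKT x).1 hx m (hST hm)
      exact har.le ⟨n, hJa hn⟩
    · ext m
      exact ⟨fun hm x hx => (hKT x).1 hx m hm, fun hm => hKT' m hm⟩
  -- The empty set cannot be V(J), since `J` lies in the proper ideal `a` and so has an internal
  -- maximal ideal above it.
  · obtain ⟨J, hJ, hJa, e⟩ := (hmem ⟨∅, isHyperfinite_image_empty⟩).1 (h ▸ Set.mem_univ _)
    obtain ⟨m, hm⟩ := exists_internalMax_of_ne_top (J := J) fun hJ1 => ha (top_le_iff.1 (hJ1 ▸ hJa))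
    exact ((congrArg Subtype.val e).ge hm : m ∈ (∅ : Set _))

/-- The ideal of all `x` such that the internal maximal ideals containing `x` include a member of
the filter `F`. -/
def filterIdeal (F : Set (N.HyperfiniteSubsets A i)) (hF : Order.IsPFilter F) :
    Ideal (N.InternalRing A i) where
  carrier := {x | ∃ S ∈ F, ∀ m ∈ S.1, x ∈ m.1}
  zero_mem' := by
    obtain ⟨S, hS⟩ := hF.Nonempty
    exact ⟨S, hS, fun m _ => zero_mem _⟩
  add_mem' := by
    rintro x y ⟨S, hS, hx⟩ ⟨T, hT, hy⟩
    obtain ⟨U, hU, hUS, hUT⟩ := hF.Directed S hS T hT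
    exact ⟨U, hU, fun m hm => add_mem (hx m (hUS hm)) (hy m (hUT hm))⟩
  smul_mem' := by
    rintro c x ⟨S, hS, hx⟩
    exact ⟨S, hS, fun m hm => Ideal.mul_mem_left _ _ (hx m hm)⟩

theorem mem_filterIdeal {F : Set (N.HyperfiniteSubsets A i)} {hF : Order.IsPFilter F}
    {x : N.InternalRing A i} : x ∈ filterIdeal F hF ↔ ∃ S ∈ F, ∀ m ∈ S.1, x ∈ m.1 := Iff.rfl

theorem filterIdeal_ne_top {F : Set (N.HyperfiniteSubsets A i)} (hF : IsProperFilter F) :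
    filterIdeal F hF.1 ≠ ⊤ := by
  intro h
  obtain ⟨S, hS, h1⟩ := mem_filterIdeal.1 ((Ideal.eq_top_iff_one _).1 h)
  refine hF.2 (Set.eq_univ_of_forall fun T => hF.1.IsLowerSet ?_ hS)
  -- Such an `S` is empty, so it lies below every `T` and the filter would be improper.
  exact fun m hm => (m.2.1.ne_top ((Ideal.eq_top_iff_one _).2 (h1 m hm))).elim

theorem isStarRadical_filterIdeal {F : Set (N.HyperfiniteSubsets A i)} (hF : Order.IsPFilter F) :
    IsStarRadical (filterIdeal F hF) := by
  refine Set.Subset.antisymm ?_ fun x hx => ⟨N.natCast 1, by rwa [hyperPow_one]⟩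
  rintro x ⟨n, S, hS, h⟩
  exact ⟨S, hS, fun m hm => m.mem_of_hyperPow_mem (h m hm)⟩

theorem isStarRadical_of_isMaximal {M : Ideal (N.InternalRing A i)} (hM : M.IsMaximal) :
    IsStarRadical M :=
  Set.Subset.antisymm (fun _ ⟨_, h⟩ => mem_of_hyperPow_mem_of_isMaximal hM h)
    fun x hx => ⟨N.natCast 1, by rwa [hyperPow_one]⟩

theorem filterIdeal_ne_bot (hB : N.IsInternalDedekind A i)
    (hfield : ¬ IsField (N.InternalRing A i)) {F : Set (N.HyperfiniteSubsets A i)}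
    (hF : Order.IsPFilter F) : filterIdeal F hF ≠ ⊥ := by
  obtain ⟨S, hS⟩ := hF.Nonempty
  obtain ⟨J, hJ, hJS, -⟩ := exists_toIdeal_eq_iInf hB hfield S
  exact fun h => hJ (le_bot_iff.1 (h ▸ fun x hx => ⟨S, hS, (hJS x).1 hx⟩))

theorem supp_divisorFilter_filterIdeal (hB : N.IsInternalDedekind A i)
    (hfield : ¬ IsField (N.InternalRing A i)) {F : Set (N.HyperfiniteSubsets A i)}
    (hF : Order.IsPFilter F) : Supp (divisorFilter (filterIdeal F hF)) = F := by
  ext S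
  rw [mem_supp_divisorFilter_iff hB]
  constructor
  · rintro ⟨J, hJ, hJF, rfl⟩
    -- Each element of `J` comes with its own member of `F`. Reducing to two generators lets
    -- directedness of `F` give one member for all of `J`.
    obtain ⟨x, y, hxy⟩ := exists_toIdeal_eq_span_sup_span hB J
    rw [hxy, sup_le_iff, Ideal.span_singleton_le_iff_mem, Ideal.span_singleton_le_iff_mem] at hJF
    obtain ⟨⟨S, hS, hx⟩, T, hT, hy⟩ := hJF
    obtain ⟨U, hU, hUS, hUT⟩ := hF.Directed S hS T hT
    refine hF.IsLowerSet (a := U) (b := zeroLocus hB J hJ) (fun m hm => ?_) hU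
    show toIdeal J ≤ m.1
    rw [hxy, sup_le_iff, Ideal.span_singleton_le_iff_mem, Ideal.span_singleton_le_iff_mem]
    exact ⟨hx m (hUS hm), hy m (hUT hm)⟩
  · intro hS
    obtain ⟨J, hJ, hJS, hJS'⟩ := exists_toIdeal_eq_iInf hB hfield S
    exact ⟨J, hJ, fun x hx => ⟨S, hS, (hJS x).1 hx⟩, Subtype.ext (Set.ext fun m =>
      ⟨fun hm x hx => (hJS x).1 hx m hm, fun hm => hJS' m hm⟩)⟩

theorem filterIdeal_supp_divisorFilter (hB : N.IsInternalDedekind A i)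
    {a : Ideal (N.InternalRing A i)} (har : IsStarRadical a)
    (hF : IsProperFilter (Supp (divisorFilter a))) : filterIdeal _ hF.1 = a := by
  apply le_antisymm
  · rintro x ⟨S, hS, hx⟩
    obtain ⟨J, hJ, hJa, rfl⟩ := (mem_supp_divisorFilter_iff hB).1 hS
    obtain ⟨n, hn⟩ := exists_hyperPow_mem hB hJ hx
    exact har.le ⟨n, hJa hn⟩
  · intro x hx
    obtain rfl | hx0 := eq_or_ne x 0
    · exact zero_mem _
    obtain ⟨J, hJ⟩ := exists_toIdeal_eq_span_singleton x
    have hJ0 : toIdeal J ≠ ⊥ := by rwa [hJ, Ne, Ideal.span_singleton_eq_bot]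
    refine ⟨zeroLocus hB J hJ0, (mem_supp_divisorFilter_iff hB).2 ⟨J, hJ0, ?_, rfl⟩, fun m hm => ?_⟩
    · rwa [hJ, Ideal.span_singleton_le_iff_mem]
    · exact hm (hJ.ge (Ideal.mem_span_singleton_self x))

theorem supp_divisorFilter_mono {a b : Ideal (N.InternalRing A i)} (h : a ≤ b) :
    Supp (divisorFilter a) ⊆ Supp (divisorFilter b) := by
  rintro S ⟨f, ⟨c, hc, hc0, hca, hf⟩, hS⟩
  exact ⟨f, ⟨c, hc, hc0, hca.trans h, hf⟩, hS⟩

theorem filterIdeal_mono {F G : Set (N.HyperfiniteSubsets A i)} (hF : Order.IsPFilter F)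
    (hG : Order.IsPFilter G) (h : F ⊆ G) : filterIdeal F hF ≤ filterIdeal G hG :=
  fun _ ⟨S, hS, hx⟩ => ⟨S, h hS, hx⟩

theorem isInternal_iff_isPrincipalFilter (hB : N.IsInternalDedekind A i)
    (hfield : ¬ IsField (N.InternalRing A i)) {a : Ideal (N.InternalRing A i)} (ha0 : a ≠ ⊥)
    (har : IsStarRadical a) (hF : IsProperFilter (Supp (divisorFilter a))) :
    IsInternal a ↔ IsPrincipalFilter (Supp (divisorFilter a)) := by
  constructor
  · intro ha
    obtain ⟨J, rfl⟩ := isInternal_iff_exists_toIdeal.1 ha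
    refine ⟨zeroLocus hB J ha0, (mem_supp_divisorFilter_iff hB).2 ⟨J, ha0, le_rfl, rfl⟩, ?_⟩
    intro S hS
    obtain ⟨K, hK, hKJ, rfl⟩ := (mem_supp_divisorFilter_iff hB).1 hS
    exact fun m hm => hKJ.trans hm
  · rintro ⟨S, hS, hmin⟩
    obtain ⟨J, hJ, hJS, -⟩ := exists_toIdeal_eq_iInf hB hfield S
    refine isInternal_iff_exists_toIdeal.2 ⟨J, ?_⟩
    -- Once `a` is written as the ideal of its filter, the least member `S` alone decides
    -- membership.
    rw [← filterIdeal_supp_divisorFilter hB har hF]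
    apply le_antisymm
    · rintro x ⟨T, hT, hx⟩
      exact (hJS x).2 fun m hm => hx m (hmin hT hm)
    · exact fun x hx => ⟨S, hS, (hJS x).1 hx⟩

/-! ### Maximal ideals and ultrafilters. -/

theorem ne_bot_of_isMaximal (hfield : ¬ IsField (N.InternalRing A i)) {M : Ideal (N.InternalRing A i)}
    (hM : M.IsMaximal) : M ≠ ⊥ := by
  have : Nontrivial (N.InternalRing A i) := by
    by_contra h
    rw [not_nontrivial_iff_subsingleton] at h
    exact hM.ne_top (Subsingleton.elim _ _)
  exact Ring.ne_bot_of_isMaximal_of_not_isField hM hfield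

theorem isUltra_supp_divisorFilter (hB : N.IsInternalDedekind A i)
    (hfield : ¬ IsField (N.InternalRing A i)) {M : Ideal (N.InternalRing A i)}
    (hM : M.IsMaximal) : IsUltra (Supp (divisorFilter M)) := by
  have hr := isStarRadical_of_isMaximal hM
  have hP := isProperFilter_supp_divisorFilter hB hfield hM.ne_top
    (ne_bot_of_isMaximal hfield hM) hr
  refine ⟨hP, fun G hG h => ?_⟩
  have h1 := filterIdeal_mono hP.1 hG.1 h
  rw [filterIdeal_supp_divisorFilter hB hr hP] at h1
  have h2 := hM.eq_of_le (filterIdeal_ne_top hG) h1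
  conv_rhs => rw [h2]
  exact (supp_divisorFilter_filterIdeal hB hfield hG.1).ge

theorem isMaximal_filterIdeal (hB : N.IsInternalDedekind A i)
    (hfield : ¬ IsField (N.InternalRing A i)) {F : Set (N.HyperfiniteSubsets A i)}
    (hF : IsUltra F) : (filterIdeal F hF.1.1).IsMaximal := by
  -- The filter of a maximal ideal above `filterIdeal F` is proper and contains `F`, so it equals
  -- `F`; hence `filterIdeal F` is that maximal ideal.
  obtain ⟨M, hM, hFM⟩ := Ideal.exists_le_maximal _ (filterIdeal_ne_top hF.1)
  have h1 := supp_divisorFilter_mono hFM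
  rw [supp_divisorFilter_filterIdeal hB hfield] at h1
  have hU := isUltra_supp_divisorFilter hB hfield hM
  have h2 : F = Supp (divisorFilter M) := hF.eq_of_le hU.1 h1
  subst h2
  rwa [filterIdeal_supp_divisorFilter hB (isStarRadical_of_isMaximal hM) hU.1]

end NonstandardEmbedding

/-! ### The two bijections. -/

open NonstandardEmbedding in
theorem mainTheorem3 (N : NonstandardEmbedding.{u, v}) {I : Type u} (A : I → Type u)
    [∀ j, CommRing (A j)] (i : N.obj I) (hB : N.IsInternalDedekind A i)
    (hfield : ¬ IsField (N.InternalRing A i)) :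
    (∃ e : {a : Ideal (N.InternalRing A i) // a ≠ ⊤ ∧ a ≠ ⊥ ∧ IsStarRadical a} ≃
        {F : Set (N.HyperfiniteSubsets A i) // IsProperFilter F},
      (∀ a, (e a).1 = Supp (divisorFilter a.1)) ∧
      (∀ F, ((e.symm F).1 : Set (N.InternalRing A i)) = idealOfFilter (Ch F.1)) ∧
      (∀ a, IsInternal a.1 ↔ IsPrincipalFilter (e a).1)) ∧
    (∃ e : {m : Ideal (N.InternalRing A i) // m.IsMaximal} ≃
        {F : Set (N.HyperfiniteSubsets A i) // IsUltra F},
      (∀ m, (e m).1 = Supp (divisorFilter m.1)) ∧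
      (∀ F, ((e.symm F).1 : Set (N.InternalRing A i)) = idealOfFilter (Ch F.1)) ∧
      (∀ m, IsInternal m.1 ↔ IsPrincipalFilter (e m).1) ∧
      (∀ m, ¬ IsInternal m.1 ↔ IsFreeFilter (e m).1)) := by
  have hcoe : ∀ (F : Set (N.HyperfiniteSubsets A i)) (hF : Order.IsPFilter F),
      (filterIdeal F hF : Set (N.InternalRing A i)) = idealOfFilter (Ch F) := fun F hF =>
    Set.ext fun x => (mem_idealOfFilter_ch_iff hB hfield).symm
  have hprop : ∀ a : {a : Ideal (N.InternalRing A i) // a ≠ ⊤ ∧ a ≠ ⊥ ∧ IsStarRadical a},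
      IsProperFilter (Supp (divisorFilter a.1)) := fun a =>
    isProperFilter_supp_divisorFilter hB hfield a.2.1 a.2.2.1 a.2.2.2
  have hmax : ∀ m : {m : Ideal (N.InternalRing A i) // m.IsMaximal},
      IsInternal m.1 ↔ IsPrincipalFilter (Supp (divisorFilter m.1)) := fun m =>
    isInternal_iff_isPrincipalFilter hB hfield (ne_bot_of_isMaximal hfield m.2)
      (isStarRadical_of_isMaximal m.2) (isUltra_supp_divisorFilter hB hfield m.2).1
  refine ⟨⟨⟨fun a => ⟨_, hprop a⟩,
      fun F => ⟨filterIdeal F.1 F.2.1, filterIdeal_ne_top F.2, filterIdeal_ne_bot hB hfield F.2.1,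
        isStarRadical_filterIdeal F.2.1⟩,
      fun a => Subtype.ext (filterIdeal_supp_divisorFilter hB a.2.2.2 (hprop a)),
      fun F => Subtype.ext (supp_divisorFilter_filterIdeal hB hfield F.2.1)⟩,
      fun _ => rfl, fun F => hcoe _ F.2.1, fun a => isInternal_iff_isPrincipalFilter hB hfield
        a.2.2.1 a.2.2.2 (hprop a)⟩,
    ⟨⟨fun m => ⟨_, isUltra_supp_divisorFilter hB hfield m.2⟩,
      fun F => ⟨filterIdeal F.1 F.2.1.1, isMaximal_filterIdeal hB hfield F.2⟩,
      fun m => Subtype.ext (filterIdeal_supp_divisorFilter hB (isStarRadical_of_isMaximal m.2)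
        (isUltra_supp_divisorFilter hB hfield m.2).1),
      fun F => Subtype.ext (supp_divisorFilter_filterIdeal hB hfield F.2.1.1)⟩,
      fun _ => rfl, fun F => hcoe _ F.2.1.1, hmax, fun m => not_congr (hmax m)⟩⟩
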